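/- **Proposition 5.1.** Let $\Lambda$ and $\Gamma$ be left and right noetherian rings and let ${}_\Lambda U_\Gamma$ be a bimodule such that ${}_\Lambda U$ is a Wakamatsu tilting module with $\Gamma=\mathrm{End}({}_\Lambda U)$ (the natural map $\Gamma\to\mathrm{End}({}_\Lambda U)^{op}$ is an isomorphism). Here ${}_\Lambda U$ is *Wakamatsu tilting* if it is finitely generated, $\mathrm{Ext}^i_\Lambda(U,U)=0$ for all $i\ge 1$, and there is an exact sequence $0\to\Lambda\to U_0\to U_1\to\cdots$ of left $\Lambda$-modules in which every $U_i$ is a direct summand of a finite direct sum of copies of $U$ and which remains exact after applying $\mathrm{Hom}_\Lambda(-,U)$. Let $E_0$ be the injective envelope of ${}_\Lambda U$, i.e. the first term of a minimal injective resolution of ${}_\Lambda U$. Notation. Let $\operatorname{mod}\Lambda$ and $\operatorname{mod}\Gamma^{op}$ be the categories of finitely generated left $\Lambda$-modules and finitely generated right $\Gamma$-modules. For a left $\Lambda$-module or right $\Gamma$-module $A$, write $A^*$ for $\mathrm{Hom}_\Lambda(A,U)$, respectively $\mathrm{Hom}_\Gamma(A,U)$, (a right $\Gamma$-module, respectively a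 left $\Lambda$-module), $f^*=\mathrm{Hom}(f,U)$, and $\sigma_A:A\to A^{**}$, $\sigma_A(x)(f)=f(x)$; $A$ is *$U$-torsionless* if $\sigma_A$ is injective. A monomorphism is *essential* if its image meets every nonzero submodule of its target nontrivially. $\operatorname{grade}_U A\ge n$ means $\mathrm{Ext}^i(A,U)=0$ for $0\le i<n$, and $\operatorname{s.grade}_U A\ge n$ means $\operatorname{grade}_U B\ge n$ for every submodule $B$ of $A$. $\operatorname{add-lim}_\Lambda U$ is the class of left $\Lambda$-modules isomorphic to direct summands of direct limits (of directed systems) of finite direct sums of copies of ${}_\Lambda U$, and $U\text{-lim.dim}_\Lambda(A)$ is the infimum of the $n\ge 0$ for which there is an exact sequence $0\to T_n\to\cdots\to T_0\to A\to 0$ with all $T_i\in\operatorname{add-lim}_\Lambda U$ ($\infty$ if there is none). The following are equivalent: 1. $U\text{-lim.dim}_\Lambda(E_0)\le 1$. 2. $\sigma_X$ is an essential monomorphism for every $U$-torsionless $X\in\operatorname{mod}\Lambda$. 3. $f^{**}$ is a monomorphism for every monomorphism $f:X\to Y$ in $\operatorname{mod}\Lambda$ with $Y$ $U$-torsionless.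 4. $f^{**}$ is a monomorphism for every monomorphism $f:X\to Y$ in $\operatorname{mod}\Lambda$ with $X$ and $Y$ both $U$-torsionless. 5. $\operatorname{grade}_U\mathrm{Ext}^1_\Lambda(X,U)\ge 1$ for every $X\in\operatorname{mod}\Lambda$. 6. $\operatorname{s.grade}_U\mathrm{Ext}^2_\Gamma(N,U)\ge 1$ for every $N\in\operatorname{mod}\Gamma^{op}$. -/

import Mathlib

open CategoryTheory CategoryTheory.Abelian

universe u

namespace UDim

/-! ### The class `add T` and Wakamatsu tilting modules -/

/-- `M ∈ add T`: `M` is (isomorphic to) a direct summand of a finite direct sum of copies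
of `T`. -/
def IsAdd (R : Type u) [Ring R] (T : Type u) [AddCommGroup T] [Module R T]
    (M : Type u) [AddCommGroup M] [Module R M] : Prop :=
  ∃ (n : ℕ) (s : M →ₗ[R] (Fin n → T)) (r : (Fin n → T) →ₗ[R] M), r ∘ₗ s = LinearMap.id

/-- A finitely generated module `U` over `R` is Wakamatsu tilting if `Ext^i(U, U) = 0` for all
`i ≥ 1` and there is an exact sequence `0 → R → W 0 → W 1 → ⋯` with all `W i ∈ add U` which stays
exact under `Hom(-, U)`. -/
structure IsWakamatsuTilting (R : Type u) [Ring R] (U : Type u) [AddCommGroup U] [Module R U] :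
    Prop where
  finite : Module.Finite R U
  selfOrthogonal : ∀ i : ℕ, 1 ≤ i → Subsingleton (Ext (ModuleCat.of R U) (ModuleCat.of R U) i)
  exists_coresolution : ∃ (W : ℕ → ModuleCat.{u} R) (ε : R →ₗ[R] W 0)
    (d : ∀ i, W i →ₗ[R] W (i + 1)),
    (∀ i, IsAdd R U (W i)) ∧
    Function.Injective ε ∧ Function.Exact ε (d 0) ∧
    (∀ i, Function.Exact (d i) (d (i + 1))) ∧
    Function.Surjective (fun g : W 0 →ₗ[R] U => g ∘ₗ ε) ∧
    Function.Exact (fun g : W 1 →ₗ[R] U => g ∘ₗ d 0) (fun g : W 0 →ₗ[R] U => g ∘ₗ ε) ∧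
    ∀ i, Function.Exact (fun g : W (i + 1 + 1) →ₗ[R] U => g ∘ₗ d (i + 1))
      (fun g : W (i + 1) →ₗ[R] U => g ∘ₗ d i)

/-! ### Injective envelopes and essential monomorphisms -/

/-- An essential monomorphism: an injective linear map whose range meets every nonzero submodule
of the target nontrivially. -/
def IsEssentialMono {R : Type u} [Ring R] {M N : Type u} [AddCommGroup M] [Module R M]
    [AddCommGroup N] [Module R N] (f : M →ₗ[R] N) : Prop :=
  Function.Injective f ∧ ∀ B : Submodule R N, LinearMap.range f ⊓ B = ⊥ → B = ⊥

/-- `j : M → E` is an injective envelope of `M`, that is, the beginning of a minimal injective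
resolution of `M`. -/
def IsInjectiveEnvelope {R : Type u} [Ring R] {M E : Type u} [AddCommGroup M] [Module R M]
    [AddCommGroup E] [Module R E] (j : M →ₗ[R] E) : Prop :=
  Module.Injective R E ∧ IsEssentialMono j

/-! ### The class `add-lim T` and the dimension `T-lim.dim` -/

/-- `M ∈ add-lim T`: `M` is (isomorphic to) a direct summand of the direct limit of a directed
system of modules each of which is a finite direct sum of copies of `T`. -/
def IsAddLim (R : Type u) [Ring R] (T : Type u) [AddCommGroup T] [Module R T]
    (M : Type u) [AddCommGroup M] [Module R M] : Prop :=
  ∃ (ι : Type u) (_ : Preorder ι) (_ : IsDirectedOrder ι) (_ : Nonempty ι)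
    (F : ι ⥤ ModuleCat.{u} R) (c : Limits.Cocone F) (_ : Limits.IsColimit c)
    (s : M →ₗ[R] c.pt) (r : c.pt →ₗ[R] M),
    (∀ i, ∃ n : ℕ, Nonempty (F.obj i ≃ₗ[R] (Fin n → T))) ∧ r ∘ₗ s = LinearMap.id

/-- There is an exact sequence `0 → W n → ⋯ → W 1 → W 0 → M → 0` with all `W i ∈ add-lim T`
(written as an infinite sequence with `W i = 0` for `i > n`). -/
def HasLimResolution (R : Type u) [Ring R] (T : Type u) [AddCommGroup T] [Module R T]
    (M : Type u) [AddCommGroup M] [Module R M] (n : ℕ) : Prop :=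
  ∃ (W : ℕ → ModuleCat.{u} R) (ε : W 0 →ₗ[R] M) (d : ∀ i, W (i + 1) →ₗ[R] W i),
    (∀ i, IsAddLim R T (W i)) ∧ (∀ i, n < i → Subsingleton (W i)) ∧
    Function.Surjective ε ∧ Function.Exact (d 0) ε ∧ ∀ i, Function.Exact (d (i + 1)) (d i)

/-- `T-lim.dim M`, the infimum of the lengths of finite resolutions of `M` by modules in
`add-lim T`; it is `⊤` if there is no such resolution. -/
noncomputable def limDim (R : Type u) [Ring R] (T : Type u) [AddCommGroup T] [Module R T]
    (M : Type u) [AddCommGroup M] [Module R M] : ℕ∞ :=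
  sInf {m : ℕ∞ | ∃ n : ℕ, m = n ∧ HasLimResolution R T M n}

/-! ### Grade and strong grade -/

/-- `grade_T A ≥ n`: `Ext^i(A, T) = 0` for `0 ≤ i < n`. -/
def GradeGE (R : Type u) [Ring R] (T : Type u) [AddCommGroup T] [Module R T]
    (A : Type u) [AddCommGroup A] [Module R A] (n : ℕ) : Prop :=
  ∀ i : ℕ, i < n → Subsingleton (Ext (ModuleCat.of R A) (ModuleCat.of R T) i)

/-- `s.grade_T A ≥ n`: every submodule of `A` has grade at least `n`. -/
def StrongGradeGE (R : Type u) [Ring R] (T : Type u) [AddCommGroup T] [Module R T]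
    (A : Type u) [AddCommGroup A] [Module R A] (n : ℕ) : Prop :=
  ∀ B : Submodule R A, GradeGE R T B n

/-! ### Duality and `Ext` with respect to a bimodule

`R` and `S` are rings acting on `U` on the left by commuting actions. A left `Λ`- right
`Γ`-bimodule is the case where the two rings are `Λ` and `Γᵐᵒᵖ` (in either order), right
`Γ`-modules being the same thing as left `Γᵐᵒᵖ`-modules. -/

section Bimodule

variable (R S U : Type u) [Ring R] [Ring S] [AddCommGroup U] [Module R U] [Module S U]
  [SMulCommClass R S U]

/-- The dual `A^* = Hom_R(A, U)`, an `S`-module through the action of `S` on `U`. -/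
abbrev UDual (A : Type u) [AddCommGroup A] [Module R A] : Type u := A →ₗ[R] U

/-- The `S`-linear map `f^* : Y^* → X^*`, `g ↦ g ∘ f`. -/
def dualMap {X Y : Type u} [AddCommGroup X] [Module R X] [AddCommGroup Y] [Module R Y]
    (f : X →ₗ[R] Y) : UDual R U Y →ₗ[S] UDual R U X where
  toFun g := g ∘ₗ f
  map_add' _ _ := rfl
  map_smul' _ _ := rfl

/-- The double dual `A^{**} = Hom_S(Hom_R(A, U), U)`, an `R`-module. -/
abbrev UDDual [SMulCommClass S R U] (A : Type u) [AddCommGroup A] [Module R A] : Type u :=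
  UDual S U (UDual R U A)

/-- `f^{**} : X^{**} → Y^{**}`. -/
def ddualMap [SMulCommClass S R U] {X Y : Type u} [AddCommGroup X] [Module R X]
    [AddCommGroup Y] [Module R Y] (f : X →ₗ[R] Y) : UDDual R S U X →ₗ[R] UDDual R S U Y :=
  dualMap S R U (dualMap R S U f)

/-- The evaluation map `σ_A : A → A^{**}`, `σ_A x f = f x`. -/
def evalMap [SMulCommClass S R U] (A : Type u) [AddCommGroup A] [Module R A] :
    A →ₗ[R] UDDual R S U A where
  toFun x :=
    { toFun := fun f => f x
      map_add' := fun _ _ => rfl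
      map_smul' := fun _ _ => rfl }
  map_add' x y := LinearMap.ext fun f => f.map_add x y
  map_smul' r x := LinearMap.ext fun f => f.map_smul r x

/-- `A` is `U`-torsionless if `σ_A` is injective. -/
def IsTorsionless [SMulCommClass S R U] (A : Type u) [AddCommGroup A] [Module R A] : Prop :=
  Function.Injective (evalMap R S U A)

variable {S} in
/-- Multiplication by `s : S` on `U`, an endomorphism in the category of `R`-modules. -/
def smulHom [SMulCommClass S R U] (s : S) : ModuleCat.of R U ⟶ ModuleCat.of R U :=
  ModuleCat.ofHom (Module.toModuleEnd R (S := S) U s)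

/-- `Ext^n_R(X, U)`, with the `S`-module structure below. (A type synonym, so that this
structure is not confused with any other one on Mathlib's `Ext`.) -/
def ExtU (X : Type u) [AddCommGroup X] [Module R X] (n : ℕ) : Type u :=
  Ext (ModuleCat.of R X) (ModuleCat.of R U) n

noncomputable instance (X : Type u) [AddCommGroup X] [Module R X] (n : ℕ) :
    AddCommGroup (ExtU R U X n) :=
  inferInstanceAs (AddCommGroup (Ext (ModuleCat.of R X) (ModuleCat.of R U) n))

/-- `s : S` acts on `Ext^n_R(X, U)` as `Ext^n_R(X, -)` of the multiplication by `s` on `U`. -/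
noncomputable instance [SMulCommClass S R U] (X : Type u) [AddCommGroup X] [Module R X] (n : ℕ) :
    Module S (ExtU R U X n) where
  smul s e := Ext.comp (show Ext (ModuleCat.of R X) (ModuleCat.of R U) n from e)
    (Ext.mk₀ (smulHom R U s)) (add_zero n)
  one_smul e := by
    have h : smulHom R U (1 : S) = 𝟙 _ := by ext x; simp [smulHom]
    change Ext.comp _ (Ext.mk₀ (smulHom R U (1 : S))) (add_zero n) = e
    rw [h]; exact Ext.comp_mk₀_id _
  mul_smul s t e := by
    have h : smulHom R U (s * t) = smulHom R U t ≫ smulHom R U s := by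
      ext x; simp [smulHom, mul_smul]
    change Ext.comp _ (Ext.mk₀ (smulHom R U (s * t))) (add_zero n) =
      Ext.comp (Ext.comp _ (Ext.mk₀ (smulHom R U t)) (add_zero n))
        (Ext.mk₀ (smulHom R U s)) (add_zero n)
    rw [h, ← Ext.mk₀_comp_mk₀]
    exact (Ext.comp_assoc _ _ _ (add_zero n) (add_zero 0) (by omega)).symm
  smul_zero s := Ext.zero_comp (X := ModuleCat.of R X) (n := n) (Ext.mk₀ (smulHom R U s)) n (add_zero n)
  smul_add s e e' := Ext.add_comp _ _ _ _
  zero_smul e := by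
    have h : smulHom R U (0 : S) = 0 := by ext x; simp [smulHom]
    change Ext.comp _ (Ext.mk₀ (smulHom R U (0 : S))) (add_zero n) = _
    rw [h, Ext.mk₀_zero]; exact Ext.comp_zero _ _ _ _ _
  add_smul s t e := by
    have h : smulHom R U (s + t) = smulHom R U s + smulHom R U t := by
      ext x; simp [smulHom, add_smul]
    change Ext.comp _ (Ext.mk₀ (smulHom R U (s + t))) (add_zero n) = _
    rw [h, Ext.mk₀_add]; exact Ext.comp_add _ _ _ _

end Bimodule

end UDim

/-! Write `R` for `Λ`, `S` for `Γᵐᵒᵖ`, and `A*` for the dual into `U`. Three facts carry the proof.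

First, the hypotheses are partly symmetric (`IsWakamatsuTilting.dual`). Dualizing the coresolution
of `R` gives a projective resolution of `U` over `S`, and dualizing once more returns the
coresolution because every `W i` in `add U` is reflexive. Hence `End_S(U) = R` and `Ext¹_S(U, U) =
0`; moreover `R` embeds in a finite power of `U`.

Second, over a noetherian ring and for finitely generated `U`, membership in `add-lim U` means that
every map from a finitely generated module factors through a finite power of `U`
(`HasFactorization`). Limits then disappear from the argument.

Third, condition 1 is tied to the other conditions through `ClosureCondition`. If all maps `X → U`
extend to `U^p ⊇ X`, then `X**` is the set of vectors of `U^p` killed by every functional that kills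
`X`, and the condition says that submodules of `X**/X` have no nonzero maps to `U`. A map from such
a submodule to `U ⊆ E₀` extends to `U^p → E₀` by injectivity. A two-term resolution of `E₀` lets
this map be lifted and factored through a power of `U`, which makes it vanish on `X**`. Conversely,
the closure condition shows that the kernel of the canonical map from a direct sum of copies of `U`
onto `E₀` lies in `add-lim U`.

The remaining links are dimension shifting. `Ext¹(X, U)` is a quotient of the dual of a first
syzygy, `Ext²(N, U)` of the dual of a second syzygy, and `X**/σ(X)` embeds in `Ext²(N, U)` for `N`
the cokernel of a dualized presentation of `X` (its transpose relative to `U`). The implications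
proved are 1 → 6 → 2 → 3 → 1 together with 3 ↔ 4 and 3 ↔ 5. -/

namespace UDim

/-! ### Long exact sequences of `Ext(-, U)` and their `S`-linear connecting maps -/

section ExtSequences

variable {R U : Type u} [Ring R] [AddCommGroup U] [Module R U]
  {A B C : Type u} [AddCommGroup A] [Module R A] [AddCommGroup B] [Module R B]
  [AddCommGroup C] [Module R C]

/-- The short exact sequence of modules given by an injective map `f`, a surjective map `g` and
exactness in the middle. -/
lemma exists_shortExact {f : A →ₗ[R] B} {g : B →ₗ[R] C} (hf : Function.Injective f)
    (hg : Function.Surjective g) (hfg : Function.Exact f g) :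
    ∃ w : ModuleCat.ofHom f ≫ ModuleCat.ofHom g = 0,
      (ShortComplex.mk (ModuleCat.ofHom f) (ModuleCat.ofHom g) w).ShortExact := by
  refine ⟨?_, ?_⟩
  · ext x
    exact hfg.apply_apply_eq_zero x
  · exact ModuleCat.shortComplex_shortExact _ hfg hf hg

lemma subsingleton_ext_of_projective [Module.Projective R A] (n : ℕ) :
    Subsingleton (ExtU R U A (n + 1)) := by
  have : Projective (ModuleCat.of R A) := (IsProjective.iff_projective (P := A)).mp inferInstance
  exact Ext.subsingleton_of_projective _ _ n

/-- The identity of `A` is a sum of maps through `B`, so every class on `A` is a sum of classes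
pulled back from `Ext^n(B, U) = 0`. A one-element `ι` treats direct summands, and coordinates with
inclusions treat finite powers. -/
lemma subsingleton_ext_of_sum_eq_id {ι : Type*} [Fintype ι] (s : ι → (A →ₗ[R] B))
    (r : ι → (B →ₗ[R] A)) (h : ∑ i, r i ∘ₗ s i = LinearMap.id) (n : ℕ)
    (hB : Subsingleton (ExtU R U B n)) : Subsingleton (ExtU R U A n) := by
  have hB' : ∀ y : Ext (ModuleCat.of R B) (ModuleCat.of R U) n, y = 0 :=
    fun y => hB.elim y 0
  have key : (𝟙 (ModuleCat.of R A)) =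
      ∑ i, ModuleCat.ofHom (s i) ≫ ModuleCat.ofHom (r i) := by
    apply ModuleCat.hom_ext
    rw [ModuleCat.hom_sum]
    simpa using h.symm
  refine ⟨fun x y => ?_⟩
  suffices H : ∀ x : Ext (ModuleCat.of R A) (ModuleCat.of R U) n, x = 0 from
    (H x).trans (H y).symm
  intro x
  rw [← Ext.mk₀_id_comp x, key, Ext.mk₀_sum, Ext.sum_comp]
  refine Finset.sum_eq_zero fun i _ => ?_
  rw [← Ext.mk₀_comp_mk₀, Ext.comp_assoc _ _ _ (zero_add 0) (zero_add n) (by omega),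
    hB' ((Ext.mk₀ (ModuleCat.ofHom (r i))).comp x (zero_add n)), Ext.comp_zero]

lemma subsingleton_ext_pi {ι : Type} [Fintype ι] [DecidableEq ι] (n : ℕ)
    (hB : Subsingleton (ExtU R U B n)) : Subsingleton (ExtU R U (ι → B) n) := by
  refine subsingleton_ext_of_sum_eq_id (ι := ι) (fun i => LinearMap.proj i)
    (fun i => LinearMap.single R (fun _ => B) i) ?_ n hB
  ext i x j
  simp

variable {S : Type u} [Ring S] [Module S U] [SMulCommClass S R U]

/-- The connecting map `Ext^n(A, U) → Ext^(n+1)(C, U)` of a short exact sequence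
`0 → A → B → C → 0`. -/
lemma exists_connecting {f : A →ₗ[R] B} {g : B →ₗ[R] C} (hf : Function.Injective f)
    (hg : Function.Surjective g) (hfg : Function.Exact f g) (n : ℕ) :
    ∃ δ : ExtU R U A n →ₗ[S] ExtU R U C (n + 1),
      (∀ x : Ext (ModuleCat.of R A) (ModuleCat.of R U) n, δ x = 0 →
        ∃ y : Ext (ModuleCat.of R B) (ModuleCat.of R U) n,
          (Ext.mk₀ (ModuleCat.ofHom f)).comp y (zero_add n) = x) ∧
      (∀ y : Ext (ModuleCat.of R B) (ModuleCat.of R U) n,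
        δ ((Ext.mk₀ (ModuleCat.ofHom f)).comp y (zero_add n)) = 0) ∧
      (Subsingleton (ExtU R U B (n + 1)) → Function.Surjective δ) := by
  obtain ⟨w, hS⟩ := exists_shortExact hf hg hfg
  refine ⟨{ toFun := fun x => hS.extClass.comp
              (show Ext (ModuleCat.of R A) (ModuleCat.of R U) n from x) (by omega)
            map_add' := fun x y => Ext.comp_add _ _ _ _
            map_smul' := fun s x => ?_ }, ?_, ?_, ?_⟩
  · exact (Ext.comp_assoc _ _ _ (by omega) (by omega) (by omega)).symm
  · intro x hx
    exact Ext.contravariant_sequence_exact₁ hS (ModuleCat.of R U) x (by omega) hx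
  · intro y
    exact ShortComplex.ShortExact.extClass_comp_assoc hS y (h := by omega)
  · intro hB x
    exact Ext.contravariant_sequence_exact₃ hS (ModuleCat.of R U) x
      (hB.elim (show ExtU R U B (n + 1) from _) (show ExtU R U B (n + 1) from (0 : Ext _ _ _)))
      (by omega)

variable [SMulCommClass R S U]

variable (R S U) in
/-- `Hom_R(A, U) = Ext^0_R(A, U)` as `S`-modules. -/
noncomputable def dualEquivExt (A : Type u) [AddCommGroup A] [Module R A] :
    UDual R U A ≃ₗ[S] ExtU R U A 0 where
  toFun φ := Ext.mk₀ (ModuleCat.ofHom φ)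
  invFun x := (Ext.homEquiv₀ (show Ext (ModuleCat.of R A) (ModuleCat.of R U) 0 from x)).hom
  left_inv φ := by
    have : Ext.homEquiv₀ (Ext.mk₀ (ModuleCat.ofHom φ)) = ModuleCat.ofHom φ :=
      Ext.homEquiv₀.apply_symm_apply _
    simp [this]
  right_inv x := by
    exact Ext.mk₀_homEquiv₀_apply (show Ext (ModuleCat.of R A) (ModuleCat.of R U) 0 from x)
  map_add' φ ψ := by
    exact Ext.mk₀_add (ModuleCat.ofHom φ) (ModuleCat.ofHom ψ)
  map_smul' s φ := by
    exact (Ext.mk₀_comp_mk₀ (ModuleCat.ofHom φ) (smulHom R U s)).symm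

lemma gradeGE_one_iff (A : Type u) [AddCommGroup A] [Module R A] :
    GradeGE R U A 1 ↔ ∀ φ : A →ₗ[R] U, φ = 0 := by
  have e : (A →ₗ[R] U) ≃ Ext (ModuleCat.of R A) (ModuleCat.of R U) 0 :=
    ((ModuleCat.homLinearEquiv (S := ℤ) (M := ModuleCat.of R A)
      (N := ModuleCat.of R U)).symm.toEquiv).trans Ext.homEquiv₀.symm
  constructor
  · intro h φ
    have := h 0 one_pos
    exact e.subsingleton.elim _ _
  · intro h i hi
    obtain rfl : i = 0 := by omega
    have : Subsingleton (A →ₗ[R] U) := ⟨fun a b => (h a).trans (h b).symm⟩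
    exact e.symm.subsingleton

variable (S) in
/-- The connecting map `Hom(A, U) → Ext^1(C, U)` of a short exact sequence `0 → A → B → C → 0`. -/
lemma exists_connecting_dual {f : A →ₗ[R] B} {g : B →ₗ[R] C} (hf : Function.Injective f)
    (hg : Function.Surjective g) (hfg : Function.Exact f g) :
    ∃ δ : UDual R U A →ₗ[S] ExtU R U C 1,
      (∀ φ, δ φ = 0 ↔ ∃ ψ : B →ₗ[R] U, ψ ∘ₗ f = φ) ∧
      (Subsingleton (ExtU R U B 1) → Function.Surjective δ) := by
  obtain ⟨δ, h₁, h₂, h₃⟩ := exists_connecting (S := S) (U := U) hf hg hfg 0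
  refine ⟨δ ∘ₗ (dualEquivExt R U S A).toLinearMap, fun φ => ⟨fun h => ?_, ?_⟩, fun h => ?_⟩
  · obtain ⟨y, hy⟩ := h₁ _ h
    obtain ⟨ψ, rfl⟩ := (dualEquivExt R U S B).surjective y
    refine ⟨ψ, (dualEquivExt R U S A).injective ?_⟩
    refine Eq.trans ?_ hy
    exact (Ext.mk₀_comp_mk₀ (ModuleCat.ofHom f) (ModuleCat.ofHom ψ)).symm
  · rintro ⟨ψ, rfl⟩
    refine Eq.trans ?_ (h₂ (Ext.mk₀ (ModuleCat.ofHom ψ)))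
    exact congrArg δ (Ext.mk₀_comp_mk₀ (ModuleCat.ofHom f) (ModuleCat.ofHom ψ)).symm
  · exact (h₃ h).comp (dualEquivExt R U S A).surjective

variable (S) in
/-- The connecting map `Hom(A, U) → Ext^2(N, U)` of an exact sequence
`0 → A → B → B' → N → 0`, spliced from `0 → A → B → C → 0` and `0 → C → B' → N → 0`. -/
lemma exists_connecting_dual_two {B' N : Type u} [AddCommGroup B'] [Module R B']
    [AddCommGroup N] [Module R N]
    {f : A →ₗ[R] B} {g : B →ₗ[R] C} (hf : Function.Injective f)
    (hg : Function.Surjective g) (hfg : Function.Exact f g)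
    {f' : C →ₗ[R] B'} {g' : B' →ₗ[R] N} (hf' : Function.Injective f')
    (hg' : Function.Surjective g') (hfg' : Function.Exact f' g')
    (hB' : Subsingleton (ExtU R U B' 1)) :
    ∃ δ : UDual R U A →ₗ[S] ExtU R U N 2,
      (∀ φ, δ φ = 0 ↔ ∃ ψ : B →ₗ[R] U, ψ ∘ₗ f = φ) ∧
      (Subsingleton (ExtU R U B 1) → Subsingleton (ExtU R U B' 2) → Function.Surjective δ) := by
  obtain ⟨δ, h₁, h₂⟩ := exists_connecting_dual (U := U) S hf hg hfg
  obtain ⟨δ', h₁', -, h₂'⟩ := exists_connecting (S := S) (U := U) hf' hg' hfg' 1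
  -- Vanishing of `Ext¹(B', U)` makes the second connecting map injective, so the composite has the
  -- same kernel as `δ`.
  have hδ' : ∀ x, δ' x = 0 → x = 0 := by
    intro x hx
    obtain ⟨y, rfl⟩ := h₁' x hx
    have hy : y = 0 := hB'.elim y (0 : Ext _ _ _)
    subst hy
    exact Ext.comp_zero _ _ _ _ _
  refine ⟨δ' ∘ₗ δ, fun φ => ?_, fun h h' => (h₂' h').comp (h₂ h)⟩
  rw [← h₁ φ]
  exact ⟨fun h => hδ' _ h, fun h => by simp [h]⟩

/-- Homomorphisms to `U` extend along monomorphisms whose cokernel has no first extensions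
by `U`. -/
lemma exists_extension {f : A →ₗ[R] B} {g : B →ₗ[R] C} (hf : Function.Injective f)
    (hg : Function.Surjective g) (hfg : Function.Exact f g)
    (hC : Subsingleton (ExtU R U C 1)) (φ : A →ₗ[R] U) : ∃ ψ : B →ₗ[R] U, ψ ∘ₗ f = φ := by
  obtain ⟨w, hS⟩ := exists_shortExact hf hg hfg
  obtain ⟨y, hy⟩ := Ext.contravariant_sequence_exact₁ hS (ModuleCat.of R U)
    (Ext.mk₀ (ModuleCat.ofHom φ)) (n₁ := 1) rfl (hC.elim _ (0 : Ext _ _ _))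
  obtain ⟨ψ, rfl⟩ := (Ext.mk₀_bijective _ _).2 y
  refine ⟨ψ.hom, ?_⟩
  rw [Ext.mk₀_comp_mk₀] at hy
  exact congrArg ModuleCat.Hom.hom ((Ext.mk₀_bijective _ _).1 hy)

end ExtSequences

/-! ### `add-lim T` as a factorization property -/

section AddLim

variable {R T : Type u} [Ring R] [AddCommGroup T] [Module R T]

variable (R T) in
/-- Every homomorphism from a finitely generated module to `M` factors through a finite direct sum
of copies of `T`. -/
def HasFactorization (M : Type u) [AddCommGroup M] [Module R M] : Prop :=
  ∀ (F : Type u) [AddCommGroup F] [Module R F] [Module.Finite R F] (f : F →ₗ[R] M),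
    ∃ (p : ℕ) (i : F →ₗ[R] (Fin p → T)) (a : (Fin p → T) →ₗ[R] M), a ∘ₗ i = f

/-- Over a noetherian ring a finitely generated module is finitely presented, so a map to a directed
colimit factors through some stage: lift the generators to one stage, then move on until the
finitely many relations die. -/
lemma IsAddLim.hasFactorization [IsNoetherianRing R] {M : Type u} [AddCommGroup M] [Module R M]
    (h : IsAddLim R T M) : HasFactorization R T M := by
  obtain ⟨ι, _, _, _, D, c, hc, s, r, hD, hrs⟩ := h
  intro F _ _ _ f
  suffices H : ∃ (i : ι) (g : F →ₗ[R] D.obj i), (c.ι.app i).hom ∘ₗ g = s ∘ₗ f by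
    obtain ⟨i, g, hg⟩ := H
    obtain ⟨p, ⟨e⟩⟩ := hD i
    refine ⟨p, e.toLinearMap ∘ₗ g, r ∘ₗ (c.ι.app i).hom ∘ₗ e.symm.toLinearMap, ?_⟩
    ext x
    have h₁ := LinearMap.congr_fun hg x
    have h₂ := LinearMap.congr_fun hrs (f x)
    simp only [LinearMap.comp_apply, LinearEquiv.coe_coe, LinearEquiv.symm_apply_apply,
      LinearMap.id_apply] at h₁ h₂ ⊢
    erw [h₁, h₂]
  obtain ⟨k, π, hπ⟩ := Module.Finite.exists_fin' R F
  have hrep : ∀ j : Fin k, ∃ (i : ι) (y : D.obj i),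
      (c.ι.app i).hom y = s (f (π (Pi.single j 1))) := fun j => by
    obtain ⟨i, y, hy⟩ := Limits.Concrete.isColimit_exists_rep D hc (s (f (π (Pi.single j 1))))
    exact ⟨i, y, hy⟩
  choose i₀ y hy using hrep
  obtain ⟨i, hi⟩ := Finite.exists_le i₀
  let g : (Fin k → R) →ₗ[R] D.obj i :=
    (Pi.basisFun R (Fin k)).constr ℕ fun j => (D.map (homOfLE (hi j))).hom (y j)
  have hι : ∀ {a b : ι} (l : a ⟶ b) (x : D.obj a),
      (c.ι.app b).hom ((D.map l).hom x) = (c.ι.app a).hom x := fun l x => by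
    rw [← c.w l]; rfl
  have hg : (c.ι.app i).hom ∘ₗ g = s ∘ₗ f ∘ₗ π := by
    refine (Pi.basisFun R (Fin k)).ext fun j => ?_
    simp only [LinearMap.comp_apply, g, Module.Basis.constr_basis]
    rw [hι, hy]
    simp
  obtain ⟨l, z, hz⟩ := Submodule.fg_iff_exists_fin_generating_family.1
    (IsNoetherian.noetherian (LinearMap.ker π))
  have hker : ∀ j : Fin l, ∃ (i' : ι) (h : i ≤ i'), (D.map (homOfLE h)).hom (g (z j)) = 0 := by
    intro j
    have h0 : π (z j) = 0 := by
      have : z j ∈ LinearMap.ker π := hz ▸ Submodule.subset_span ⟨j, rfl⟩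
      exact this
    have h1 : (c.ι.app i).hom (g (z j)) = (c.ι.app i).hom 0 := by
      have := LinearMap.congr_fun hg (z j)
      simp only [LinearMap.comp_apply, h0, map_zero] at this ⊢
      exact this
    obtain ⟨i', u, v, huv⟩ := Limits.Concrete.isColimit_exists_of_rep_eq D hc _ _ h1
    refine ⟨i', leOfHom u, ?_⟩
    refine Eq.trans ?_ (huv.trans (map_zero (D.map v).hom))
    rfl
  choose i₁ hi₁ hzero using hker
  -- The index `none` forces the bound to lie above `i` even when there are no relations.
  obtain ⟨i₂, hi₂⟩ := Finite.exists_le (fun o : Option (Fin l) => o.elim i i₁)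
  have hi2 : i ≤ i₂ := hi₂ none
  let g' : (Fin k → R) →ₗ[R] D.obj i₂ := (D.map (homOfLE hi2)).hom ∘ₗ g
  have hg' : LinearMap.ker π ≤ LinearMap.ker g' := by
    rw [← hz, Submodule.span_le]
    rintro _ ⟨j, rfl⟩
    have hj : i₁ j ≤ i₂ := hi₂ (some j)
    have h3 : homOfLE hi2 = homOfLE (hi₁ j) ≫ homOfLE hj := rfl
    change (D.map (homOfLE hi2)).hom (g (z j)) = 0
    rw [h3, D.map_comp]
    change (D.map (homOfLE hj)).hom ((D.map (homOfLE (hi₁ j))).hom (g (z j))) = 0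
    rw [hzero, map_zero]
  refine ⟨i₂, (LinearMap.ker π).liftQ g' hg' ∘ₗ (π.quotKerEquivOfSurjective hπ).symm.toLinearMap,
    ?_⟩
  ext x
  obtain ⟨v, rfl⟩ := hπ x
  have hv : (π.quotKerEquivOfSurjective hπ).symm (π v) = (LinearMap.ker π).mkQ v := by
    rw [LinearEquiv.symm_apply_eq]; rfl
  simp only [LinearMap.comp_apply, LinearEquiv.coe_coe, hv]
  change (c.ι.app i₂).hom ((D.map (homOfLE hi2)).hom (g v)) = _
  rw [hι]
  exact LinearMap.congr_fun hg v

variable (R T) in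
/-- The category of finite direct sums of copies of `T` over `M`. -/
structure PowerOver (M : Type u) [AddCommGroup M] [Module R M] : Type u where
  n : ℕ
  hom : (Fin n → T) →ₗ[R] M

namespace PowerOver

variable {M : Type u} [AddCommGroup M] [Module R M]

instance : SmallCategory (PowerOver R T M) where
  Hom X Y := { g : (Fin X.n → T) →ₗ[R] (Fin Y.n → T) // Y.hom ∘ₗ g = X.hom }
  id X := ⟨LinearMap.id, rfl⟩
  comp {X Y Z} f g := ⟨g.1 ∘ₗ f.1, by rw [← LinearMap.comp_assoc, g.2, f.2]⟩

variable (R T M) in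
/-- The diagram of the finite direct sums of copies of `T` over `M`. -/
def diagram : PowerOver R T M ⥤ ModuleCat.{u} R where
  obj X := ModuleCat.of R (Fin X.n → T)
  map f := ModuleCat.ofHom f.1
  map_id _ := rfl
  map_comp _ _ := rfl

variable (R T M) in
/-- The canonical cocone over `diagram` with point `M`. -/
def cocone : Limits.Cocone (diagram R T M) where
  pt := ModuleCat.of R M
  ι :=
    { app := fun X => ModuleCat.ofHom X.hom
      naturality := fun X Y f => by
        apply ModuleCat.hom_ext
        exact f.2 }

variable [Module.Finite R T] (hM : HasFactorization R T M)

include hM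

omit [Module.Finite R T] in
lemma exists_hom_apply_eq (x : M) : ∃ (X : PowerOver R T M) (y : Fin X.n → T), X.hom y = x := by
  obtain ⟨p, i, a, hia⟩ := hM R (LinearMap.toSpanSingleton R M x)
  refine ⟨⟨p, a⟩, i 1, ?_⟩
  rw [← LinearMap.comp_apply, hia, LinearMap.toSpanSingleton_apply, one_smul]

/-- The quotient by `N` is finitely generated and still maps to `M`, so that map factors through a
power of `T`. This single construction provides coequalizing arrows and also identifies elements
with equal image in `M`. -/
lemma exists_hom_of_le_ker (X : PowerOver R T M) (N : Submodule R (Fin X.n → T))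
    (hN : N ≤ LinearMap.ker X.hom) :
    ∃ (Y : PowerOver R T M) (g : X ⟶ Y), ∀ x ∈ N, g.1 x = 0 := by
  obtain ⟨p, i, a, hia⟩ := hM ((Fin X.n → T) ⧸ N) (N.liftQ X.hom hN)
  refine ⟨⟨p, a⟩, ⟨i ∘ₗ N.mkQ, ?_⟩, fun x hx => ?_⟩
  · rw [← LinearMap.comp_assoc, hia, Submodule.liftQ_mkQ]
  · have : N.mkQ x = 0 := by simpa using hx
    simp only [LinearMap.comp_apply, this, map_zero]

lemma isFiltered : IsFiltered (PowerOver R T M) := by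
  have : Nonempty (PowerOver R T M) := ⟨⟨0, 0⟩⟩
  have : IsFilteredOrEmpty (PowerOver R T M) := by
    refine ⟨fun X Y => ?_, fun X Y f g => ?_⟩
    · obtain ⟨p, i, a, hia⟩ := hM ((Fin X.n → T) × (Fin Y.n → T)) (X.hom.coprod Y.hom)
      refine ⟨⟨p, a⟩, ⟨i ∘ₗ LinearMap.inl R _ _, ?_⟩, ⟨i ∘ₗ LinearMap.inr R _ _, ?_⟩, trivial⟩
      · rw [← LinearMap.comp_assoc, hia, LinearMap.coprod_inl]
      · rw [← LinearMap.comp_assoc, hia, LinearMap.coprod_inr]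
    · obtain ⟨Z, h, hh⟩ := exists_hom_of_le_ker hM Y (LinearMap.range (f.1 - g.1)) (by
        rintro _ ⟨x, rfl⟩
        have h₁ := LinearMap.congr_fun f.2 x
        have h₂ := LinearMap.congr_fun g.2 x
        simp only [LinearMap.comp_apply] at h₁ h₂
        simp [h₁, h₂])
      refine ⟨Z, h, Subtype.ext (LinearMap.ext fun x => ?_)⟩
      have := hh _ ⟨x, rfl⟩
      rw [LinearMap.sub_apply, map_sub, sub_eq_zero] at this
      exact this
  exact {}

lemma nonempty_isColimit : Nonempty (Limits.IsColimit (cocone R T M)) := by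
  have := isFiltered hM
  have : Limits.ReflectsColimit (diagram R T M) (forget (ModuleCat.{u} R)) :=
    Limits.reflectsColimit_of_reflectsIsomorphisms _ _
  refine ⟨Limits.isColimitOfReflects (forget (ModuleCat.{u} R)) ?_⟩
  refine Limits.Types.FilteredColimit.isColimitOf' _ _ (fun x => ?_) (fun X x y hxy => ?_)
  · obtain ⟨X, y, hy⟩ := exists_hom_apply_eq hM x
    exact ⟨X, y, hy.symm⟩
  · obtain ⟨Y, g, hg⟩ := exists_hom_of_le_ker hM X (Submodule.span R {(show Fin X.n → T from x) -
      (show Fin X.n → T from y)}) (by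
        rw [Submodule.span_singleton_le_iff_mem, LinearMap.mem_ker, map_sub, sub_eq_zero]
        exact hxy)
    refine ⟨Y, g, ?_⟩
    have := hg _ (Submodule.mem_span_singleton_self _)
    rw [map_sub, sub_eq_zero] at this
    exact this

end PowerOver

/-- `M` is the colimit of all finite powers of `T` over it, and this category is filtered. A final
functor from a directed set replaces the filtered category by the directed system that the
definition asks for. -/
lemma HasFactorization.isAddLim [Module.Finite R T] {M : Type u} [AddCommGroup M] [Module R M]
    (hM : HasFactorization R T M) : IsAddLim R T M := by
  have := PowerOver.isFiltered hM
  obtain ⟨hc⟩ := PowerOver.nonempty_isColimit hM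
  obtain ⟨ι, _, _, _, F, _⟩ := IsFiltered.exists_directed (PowerOver R T M)
  refine ⟨ι, inferInstance, ‹_›, ‹_›, F ⋙ PowerOver.diagram R T M,
    (PowerOver.cocone R T M).whisker F, (Functor.Final.isColimitWhiskerEquiv F _).symm hc,
    LinearMap.id, LinearMap.id, fun i => ⟨(F.obj i).n, ⟨LinearEquiv.refl R _⟩⟩, rfl⟩

end AddLim

/-! ### Duals of modules in `add U` and the symmetry of the tilting hypotheses -/

section Duality

variable {R S U : Type u} [Ring R] [Ring S] [AddCommGroup U] [Module R U] [Module S U]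
  [SMulCommClass R S U] [SMulCommClass S R U]

omit [SMulCommClass R S U] in
lemma eq_zero_of_smul_eq_zero (hS : Function.Injective (Module.toModuleEnd R (S := S) U))
    {s : S} (h : ∀ u : U, s • u = 0) : s = 0 := by
  refine hS ?_
  rw [map_zero]
  ext u
  exact h u

omit [SMulCommClass R S U] in
lemma exists_smul_eq (hS : Function.Surjective (Module.toModuleEnd R (S := S) U))
    (φ : U →ₗ[R] U) : ∃ s : S, ∀ u, φ u = s • u := by
  obtain ⟨s, rfl⟩ := hS φ
  exact ⟨s, fun _ => rfl⟩

omit [SMulCommClass S R U] in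
lemma linearMap_pi_eq_sum {n : ℕ} (h : ∀ φ : U →ₗ[R] U, ∃ s : S, ∀ u, φ u = s • u)
    (φ : (Fin n → U) →ₗ[R] U) :
    ∃ s : Fin n → S, φ = ∑ k, s k • (LinearMap.proj k : (Fin n → U) →ₗ[R] U) := by
  choose s hs using fun k => h (φ ∘ₗ LinearMap.single R (fun _ => U) k)
  refine ⟨s, ?_⟩
  ext k u
  have := hs k u
  simp only [LinearMap.comp_apply] at this ⊢
  rw [this]
  simp [LinearMap.sum_apply, Pi.single_apply]

omit [SMulCommClass S R U] in
lemma finite_dual_pi (hS : ∀ φ : U →ₗ[R] U, ∃ s : S, ∀ u, φ u = s • u) (n : ℕ) :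
    Module.Finite S (UDual R U (Fin n → U)) := by
  refine Module.Finite.of_surjective
    (Fintype.linearCombination S (fun k => (LinearMap.proj k : (Fin n → U) →ₗ[R] U))) fun φ => ?_
  obtain ⟨s, rfl⟩ := linearMap_pi_eq_sum hS φ
  exact ⟨s, rfl⟩

lemma projective_dual_pi (hS : Function.Bijective (Module.toModuleEnd R (S := S) U)) (n : ℕ) :
    Module.Projective S (UDual R U (Fin n → U)) := by
  refine Module.Projective.of_equiv (LinearEquiv.ofBijective
    (Fintype.linearCombination S (fun k => (LinearMap.proj k : (Fin n → U) →ₗ[R] U)))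
    ⟨?_, fun φ => ?_⟩)
  · rw [injective_iff_map_eq_zero]
    intro s hs
    funext k
    refine eq_zero_of_smul_eq_zero hS.1 fun u => ?_
    have := LinearMap.congr_fun hs (Pi.single k u)
    simpa [Fintype.linearCombination_apply, LinearMap.sum_apply, Pi.single_apply] using this
  · obtain ⟨s, rfl⟩ := linearMap_pi_eq_sum (exists_smul_eq hS.2) φ
    exact ⟨s, rfl⟩

namespace IsAdd

variable {W : Type u} [AddCommGroup W] [Module R W]

omit [SMulCommClass S R U] in
lemma finite_dual (hS : ∀ φ : U →ₗ[R] U, ∃ s : S, ∀ u, φ u = s • u) (hW : IsAdd R U W) :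
    Module.Finite S (UDual R U W) := by
  obtain ⟨n, s, r, hrs⟩ := hW
  have := finite_dual_pi hS n
  refine Module.Finite.of_surjective (dualMap R S U s) fun φ => ⟨φ ∘ₗ r, ?_⟩
  change (φ ∘ₗ r) ∘ₗ s = φ
  rw [LinearMap.comp_assoc, hrs, LinearMap.comp_id]

lemma projective_dual (hS : Function.Bijective (Module.toModuleEnd R (S := S) U))
    (hW : IsAdd R U W) : Module.Projective S (UDual R U W) := by
  obtain ⟨n, s, r, hrs⟩ := hW
  have := projective_dual_pi hS n
  refine Module.Projective.of_split (dualMap R S U r) (dualMap R S U s) ?_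
  ext φ : 1
  change (φ ∘ₗ r) ∘ₗ s = φ
  rw [LinearMap.comp_assoc, hrs, LinearMap.comp_id]

/-- A functional on `U^n` is an `S`-combination of coordinates, so a double-dual element is
determined by its values on the coordinates. These values form a vector of `U^n`, which `r` carries
to `W`. -/
lemma evalMap_surjective (hS : ∀ φ : U →ₗ[R] U, ∃ s : S, ∀ u, φ u = s • u) (hW : IsAdd R U W) :
    Function.Surjective (evalMap R S U W) := by
  obtain ⟨n, s, r, hrs⟩ := hW
  intro ξ
  refine ⟨r fun k => ξ (LinearMap.proj k ∘ₗ s), ?_⟩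
  ext g
  change g (r _) = ξ g
  obtain ⟨t, ht⟩ := linearMap_pi_eq_sum hS (g ∘ₗ r)
  have hg : g = dualMap R S U s (g ∘ₗ r) := by
    change g = (g ∘ₗ r) ∘ₗ s
    rw [LinearMap.comp_assoc, hrs, LinearMap.comp_id]
  conv_rhs => rw [hg, ht]
  rw [← LinearMap.comp_apply, ht]
  simp only [map_sum, map_smul, LinearMap.sum_apply, LinearMap.smul_apply, LinearMap.proj_apply]
  rfl

omit [Module S U] [SMulCommClass R S U] [SMulCommClass S R U] in
lemma eq_zero_of_forall (hW : IsAdd R U W) {w : W} (h : ∀ g : W →ₗ[R] U, g w = 0) : w = 0 := by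
  obtain ⟨n, s, r, hrs⟩ := hW
  have hs : s w = 0 := funext fun k => h (LinearMap.proj k ∘ₗ s)
  rw [← LinearMap.id_apply (R := R) w, ← hrs, LinearMap.comp_apply, hs, map_zero]

lemma subsingleton_ext (hW : IsAdd R U W) (n : ℕ) (hU : Subsingleton (ExtU R U U n)) :
    Subsingleton (ExtU R U W n) := by
  obtain ⟨m, s, r, hrs⟩ := hW
  exact subsingleton_ext_of_sum_eq_id (ι := Unit) (fun _ => s) (fun _ => r) (by simpa using hrs) n
    (subsingleton_ext_pi n hU)

end IsAdd

/-- The part of the Wakamatsu tilting property of `U` over `S` that follows from the one over `R`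
by dualizing the coresolution of `R`. -/
theorem IsWakamatsuTilting.dual (hU : IsWakamatsuTilting R U)
    (hS : Function.Bijective (Module.toModuleEnd R (S := S) U)) :
    Module.Finite S U ∧ (∀ φ : U →ₗ[S] U, ∃ r : R, ∀ u, φ u = r • u) ∧
      Subsingleton (ExtU S U U 1) ∧
      ∃ (n : ℕ) (e : R →ₗ[R] (Fin n → U)), Function.Injective e := by
  obtain ⟨W, ε, d, hW, hε, hεd, hd, hsurj, hex₀, hex⟩ := hU.exists_coresolution
  have hend := exists_smul_eq hS.2
  -- evaluation at `ε 1`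
  let p : UDual R U (W 0) →ₗ[S] U :=
    { toFun := fun g => g (ε 1)
      map_add' := fun _ _ => rfl
      map_smul' := fun _ _ => rfl }
  have hp : Function.Surjective p := fun u => by
    obtain ⟨g, hg⟩ := hsurj (LinearMap.toSpanSingleton R U u)
    refine ⟨g, ?_⟩
    have := LinearMap.congr_fun hg 1
    simpa [p] using this
  have hker : ∀ g : W 0 →ₗ[R] U, p g = 0 ↔ ∃ g' : W 1 →ₗ[R] U, g' ∘ₗ d 0 = g := fun g => by
    rw [← Set.mem_range (f := fun g' : W 1 →ₗ[R] U => g' ∘ₗ d 0), ← hex₀ g]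
    constructor
    · intro h
      ext
      exact h
    · intro h
      exact LinearMap.congr_fun h 1
  have hfin := (hW 0).finite_dual hend
  have hproj := (hW 0).projective_dual hS
  refine ⟨Module.Finite.of_surjective p hp, fun φ => ?_, ?_, ?_⟩
  -- By reflexivity of `W 0`, the map `φ ∘ p` is evaluation at some `w`. It kills the functionals
  -- that factor through `d 0`, so `d 0 w = 0` and `w` comes from `R`.
  · obtain ⟨w, hw⟩ := (hW 0).evalMap_surjective hend (φ ∘ₗ p)
    have hw' : ∀ g : W 0 →ₗ[R] U, g w = φ (p g) := fun g => LinearMap.congr_fun hw g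
    have hdw : d 0 w = 0 := (hW 1).eq_zero_of_forall fun g => by
      have := hw' (g ∘ₗ d 0)
      rwa [(hker _).2 ⟨g, rfl⟩, map_zero] at this
    obtain ⟨r, rfl⟩ := (hεd w).1 hdw
    refine ⟨r, fun u => ?_⟩
    obtain ⟨g, rfl⟩ := hp u
    rw [← hw']
    change g (ε r) = r • g (ε 1)
    rw [← map_smul, ← map_smul, smul_eq_mul, mul_one]
  · obtain ⟨δ, hδ, hδ'⟩ := exists_connecting_dual (R := S) (U := U) R
      (f := (LinearMap.ker p).subtype) (g := p) (Submodule.injective_subtype _) hp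
      (LinearMap.exact_subtype_ker_map p)
    have hδs := hδ' (subsingleton_ext_of_projective 0)
    suffices H : ∀ x, δ x = 0 from
      ⟨fun a b => by
        obtain ⟨a, rfl⟩ := hδs a
        obtain ⟨b, rfl⟩ := hδs b
        rw [H, H]⟩
    intro φ
    rw [hδ]
    -- `(W 1)*` covers the syzygy `ker p`, so `φ ∘ π` is evaluation at some `w` in `W 1`. Exactness
    -- at `W 1` writes `w = d 0 w₀`, and evaluation at `w₀` extends `φ` to `(W 0)*`.
    let π : UDual R U (W 1) →ₗ[S] LinearMap.ker p :=
      (dualMap R S U (d 0)).codRestrict _ fun g => (hker _).2 ⟨g, rfl⟩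
    obtain ⟨w, hw⟩ := (hW 1).evalMap_surjective hend (φ ∘ₗ π)
    have hw' : ∀ g : W 1 →ₗ[R] U, g w = φ (π g) := fun g => LinearMap.congr_fun hw g
    have hdw : d 1 w = 0 := (hW 2).eq_zero_of_forall fun g => by
      have h0 : π (g ∘ₗ d 1) = 0 := by
        refine Subtype.ext (LinearMap.ext fun x => ?_)
        change g (d 1 (d 0 x)) = 0
        rw [(hd 0).apply_apply_eq_zero, map_zero]
      have := hw' (g ∘ₗ d 1)
      rwa [h0, map_zero] at this
    obtain ⟨w₀, rfl⟩ := (hd 0 w).1 hdw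
    refine ⟨evalMap R S U (W 0) w₀, ?_⟩
    ext ⟨k, hk⟩
    obtain ⟨g, rfl⟩ := (hker k).1 hk
    exact hw' g
  · obtain ⟨n, s, r, hrs⟩ := hW 0
    have hs : Function.Injective s :=
      Function.LeftInverse.injective (g := r) fun x => LinearMap.congr_fun hrs x
    exact ⟨n, s ∘ₗ ε, hs.comp hε⟩

/-! ### Approximations by finite direct sums of copies of `U` -/

variable (R S U) in
omit [SMulCommClass S R U] in
/-- Every module of homomorphisms from a finitely generated module to `U` is noetherian. -/
lemma isNoetherian_dual [IsNoetherianRing S] [Module.Finite S U] (F : Type u) [AddCommGroup F]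
    [Module R F] [Module.Finite R F] : IsNoetherian S (UDual R U F) := by
  obtain ⟨k, π, hπ⟩ := Module.Finite.exists_fin' R F
  let e : UDual R U F →ₗ[S] (Fin k → U) :=
    LinearMap.pi fun j =>
      { toFun := fun φ => φ (π (Pi.single j 1))
        map_add' := fun _ _ => rfl
        map_smul' := fun _ _ => rfl }
  refine isNoetherian_of_injective e ?_
  rw [← LinearMap.ker_eq_bot, LinearMap.ker_eq_bot']
  intro φ hφ
  have : φ ∘ₗ π = 0 := by
    refine (Pi.basisFun R (Fin k)).ext fun j => ?_
    have := congrFun hφ j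
    simpa [e] using this
  ext x
  obtain ⟨v, rfl⟩ := hπ x
  exact LinearMap.congr_fun this v

omit [SMulCommClass S R U] in
/-- A family of generators of a submodule of the dual. -/
lemma exists_generators {F : Type u} [AddCommGroup F] [Module R F]
    [IsNoetherian S (UDual R U F)] (D : Submodule S (UDual R U F)) :
    ∃ (p : ℕ) (i : F →ₗ[R] (Fin p → U)), (∀ k, LinearMap.proj k ∘ₗ i ∈ D) ∧
      ∀ φ ∈ D, ∃ t : Fin p → S, φ = ∑ k, t k • (LinearMap.proj k ∘ₗ i) := by
  obtain ⟨p, g, hg⟩ := Submodule.fg_iff_exists_fin_generating_family.1 (IsNoetherian.noetherian D)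
  refine ⟨p, LinearMap.pi g, fun k => ?_, fun φ hφ => ?_⟩
  · rw [LinearMap.proj_pi, ← hg]
    exact Submodule.subset_span ⟨k, rfl⟩
  · rw [← hg, Submodule.mem_span_range_iff_exists_fun] at hφ
    obtain ⟨t, rfl⟩ := hφ
    exact ⟨t, by simp⟩

end Duality

/-! ### The double dual of a submodule of `U^p` as a closure -/

section Closure

variable {R U : Type u} [Ring R] [AddCommGroup U] [Module R U]

/-- The set of elements of `U^p` on which every homomorphism to `U` vanishing on `X` vanishes. -/
def dualClosure {p : ℕ} (X : Submodule R (Fin p → U)) : Submodule R (Fin p → U) where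
  carrier := {v | ∀ ψ : (Fin p → U) →ₗ[R] U, (∀ x ∈ X, ψ x = 0) → ψ v = 0}
  zero_mem' ψ _ := map_zero ψ
  add_mem' ha hb ψ hψ := by rw [map_add, ha ψ hψ, hb ψ hψ, add_zero]
  smul_mem' r v hv ψ hψ := by rw [map_smul, hv ψ hψ, smul_zero]

variable (R U) in
/-- Let `X ≤ U^p` be such that every homomorphism `X → U` extends to `U^p`, so that `dualClosure X`
is the double dual of `X`. Then no nonzero submodule of `dualClosure X / X` has a nonzero
homomorphism to `U`. -/
def ClosureCondition : Prop :=
  ∀ (p : ℕ) (X : Submodule R (Fin p → U)),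
    (∀ φ : X →ₗ[R] U, ∃ ψ : (Fin p → U) →ₗ[R] U, ψ ∘ₗ X.subtype = φ) →
    ∀ (Z : Type u) [AddCommGroup Z] [Module R Z] (q : Z →ₗ[R] (Fin p → U)) (h : Z →ₗ[R] U),
      (∀ z, q z ∈ dualClosure X) → (∀ z, q z ∈ X → h z = 0) → h = 0

end Closure

/-! ### Essential evaluation maps, double duals of monomorphisms, and grades -/

section Equivalences

variable {R S U : Type u} [Ring R] [Ring S] [AddCommGroup U] [Module R U] [Module S U]
  [SMulCommClass R S U] [SMulCommClass S R U]

variable (R S U) in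
/-- `σ_X` is an essential monomorphism for every finitely generated torsionless `X`. -/
def EvalEssential : Prop :=
  ∀ (X : Type u) [AddCommGroup X] [Module R X] [Module.Finite R X],
    IsTorsionless R S U X → IsEssentialMono (evalMap R S U X)

variable (R S U) in
/-- Double duality preserves monomorphisms of finitely generated modules with torsionless
target. -/
def DDualPreservesMono : Prop :=
  ∀ (X Y : Type u) [AddCommGroup X] [Module R X] [Module.Finite R X]
    [AddCommGroup Y] [Module R Y] [Module.Finite R Y] (f : X →ₗ[R] Y),
    Function.Injective f → IsTorsionless R S U Y → Function.Injective (ddualMap R S U f)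

lemma isTorsionless_of_forall {X : Type u} [AddCommGroup X] [Module R X]
    (h : ∀ x : X, (∀ φ : X →ₗ[R] U, φ x = 0) → x = 0) : IsTorsionless R S U X := by
  refine (injective_iff_map_eq_zero _).2 fun x hx => h x fun φ => LinearMap.congr_fun hx φ

lemma IsTorsionless.eq_zero {X : Type u} [AddCommGroup X] [Module R X]
    (h : IsTorsionless R S U X) {x : X} (hx : ∀ φ : X →ₗ[R] U, φ x = 0) : x = 0 :=
  (injective_iff_map_eq_zero _).1 h x (LinearMap.ext hx)

lemma IsTorsionless.of_injective {X Y : Type u} [AddCommGroup X] [Module R X] [AddCommGroup Y]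
    [Module R Y] (h : IsTorsionless R S U Y) {f : X →ₗ[R] Y} (hf : Function.Injective f) :
    IsTorsionless R S U X :=
  isTorsionless_of_forall fun x hx =>
    (injective_iff_map_eq_zero f).1 hf x (h.eq_zero fun φ => hx (φ ∘ₗ f))

lemma isTorsionless_pi (p : ℕ) : IsTorsionless R S U (Fin p → U) :=
  isTorsionless_of_forall fun _ hx => funext fun k => hx (LinearMap.proj k)

omit [Module S U] [SMulCommClass R S U] [SMulCommClass S R U] in
lemma eq_zero_of_forall_pi (hR : ∀ r : R, (∀ u : U, r • u = 0) → r = 0) {n : ℕ} {x : Fin n → R}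
    (hx : ∀ φ : (Fin n → R) →ₗ[R] U, φ x = 0) : x = 0 :=
  funext fun k => hR _ fun u => hx ((LinearMap.toSpanSingleton R U u).comp (LinearMap.proj k))

/-- The dual of `R^n` is `U^n`, and restricting `ξ` to the `k`-th copy of `U` gives an
`S`-endomorphism, that is, multiplication by some `r k`. -/
lemma evalMap_pi_surjective (hR : ∀ φ : U →ₗ[S] U, ∃ r : R, ∀ u, φ u = r • u) (n : ℕ) :
    Function.Surjective (evalMap R S U (Fin n → R)) := by
  intro ξ
  let c (k : Fin n) : U →ₗ[S] UDual R U (Fin n → R) :=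
    { toFun := fun u => (LinearMap.toSpanSingleton R U u).comp (LinearMap.proj k)
      map_add' := fun u v => by ext; simp
      map_smul' := fun s u => by ext; simp [smul_comm _ s] }
  choose r hr using fun k => hR (ξ ∘ₗ c k)
  refine ⟨r, ?_⟩
  ext φ
  have hφ : φ = ∑ k, c k (φ (Pi.single k 1)) := by
    refine (Pi.basisFun R (Fin n)).ext fun j => ?_
    simp [c, LinearMap.sum_apply, Pi.single_apply, ite_smul]
  conv_rhs => rw [hφ, map_sum]
  change φ r = _
  conv_lhs => rw [hφ, LinearMap.sum_apply]
  exact Finset.sum_congr rfl fun k _ => (hr k _).symm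

omit [SMulCommClass S R U] in
lemma isAdd_dual_pi (n : ℕ) : IsAdd S U (UDual R U (Fin n → R)) := by
  refine ⟨n, LinearMap.pi fun k =>
      { toFun := fun φ => φ (Pi.single k 1)
        map_add' := fun _ _ => rfl
        map_smul' := fun _ _ => rfl },
    { toFun := fun v => Fintype.linearCombination R v
      map_add' := fun v w => by ext; simp
      map_smul' := fun s v => by ext; simp }, ?_⟩
  ext φ k
  simp

omit [SMulCommClass S R U] in
-- The coordinates of `i` are chosen to generate the `S`-module `F*`, which is noetherian.
lemma exists_approximation [IsNoetherianRing S] [Module.Finite S U] (F : Type u) [AddCommGroup F]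
    [Module R F] [Module.Finite R F] : ∃ (p : ℕ) (i : F →ₗ[R] (Fin p → U)),
      ∀ φ : F →ₗ[R] U, ∃ ψ : (Fin p → U) →ₗ[R] U, ψ ∘ₗ i = φ := by
  have := isNoetherian_dual R S U F
  obtain ⟨p, i, -, hi⟩ := exists_generators (⊤ : Submodule S (UDual R U F))
  refine ⟨p, i, fun φ => ?_⟩
  obtain ⟨t, rfl⟩ := hi φ trivial
  refine ⟨∑ k, t k • LinearMap.proj k, ?_⟩
  ext x
  simp [LinearMap.sum_apply]

lemma IsTorsionless.exists_injective [IsNoetherianRing S] [Module.Finite S U] {F : Type u}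
    [AddCommGroup F] [Module R F] [Module.Finite R F] (hF : IsTorsionless R S U F) :
    ∃ (p : ℕ) (i : F →ₗ[R] (Fin p → U)), Function.Injective i := by
  obtain ⟨p, i, hi⟩ := exists_approximation (R := R) (S := S) (U := U) F
  refine ⟨p, i, (injective_iff_map_eq_zero _).2 fun x hx => hF.eq_zero fun φ => ?_⟩
  obtain ⟨ψ, rfl⟩ := hi φ
  rw [LinearMap.comp_apply, hx, map_zero]

/-- By naturality of `σ`, the kernel of `f**` meets `σ(X)` only in zero, so essentiality makes it
vanish. -/
lemma EvalEssential.ddualPreservesMono (h : EvalEssential R S U) : DDualPreservesMono R S U := by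
  intro X Y _ _ _ _ _ _ f hf hY
  have hX : IsTorsionless R S U X := hY.of_injective hf
  rw [← LinearMap.ker_eq_bot]
  refine (h X hX).2 _ (eq_bot_iff.2 ?_)
  rintro _ ⟨⟨x, rfl⟩, hx⟩
  have : evalMap R S U Y (f x) = 0 := hx
  rw [(injective_iff_map_eq_zero f).1 hf x ((injective_iff_map_eq_zero _).1 hY _ this), map_zero]
  exact Submodule.zero_mem _

/-- The quotient `(X × Z) / K` is a copy of `X + q(Z) ⊆ U^p`, and `h` descends to a functional `h'`
on it vanishing on `X`. A point `q z` of the closure also defines `η` in `X**`. The evaluation at `q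
z` and the image of `η` agree in `(U^p)**`, hence already in `(X + q(Z))**`, and applying both to
`h'` gives `h z = η 0 = 0`. -/
lemma DDualPreservesMono.closureCondition [IsNoetherianRing R] [Module.Finite R U]
    (H : DDualPreservesMono R S U) : ClosureCondition R U := by
  intro p X hX Z _ _ q h hq hh
  ext z
  let g : (X × Z) →ₗ[R] (Fin p → U) := X.subtype.coprod q
  let K := LinearMap.ker g
  let f : ((X × Z) ⧸ K) →ₗ[R] (Fin p → U) := K.liftQ g le_rfl
  have hf : Function.Injective f := LinearMap.ker_eq_bot.1 (Submodule.ker_liftQ_eq_bot _ _ _ le_rfl)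
  have := Module.Finite.of_injective f hf
  let h' : ((X × Z) ⧸ K) →ₗ[R] U := K.liftQ (h ∘ₗ LinearMap.snd R X Z) (by
    rintro ⟨x, z⟩ hxz
    have hxz' : (x : Fin p → U) + q z = 0 := by simpa [K, g] using hxz
    exact hh z (by rw [eq_neg_of_add_eq_zero_right hxz']; exact X.neg_mem x.2))
  let i : X →ₗ[R] ((X × Z) ⧸ K) := K.mkQ ∘ₗ LinearMap.inl R X Z
  choose E hE using hX
  have hE' : ∀ ψ ψ' : (Fin p → U) →ₗ[R] U, ψ ∘ₗ X.subtype = ψ' ∘ₗ X.subtype →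
      ψ (q z) = ψ' (q z) := fun ψ ψ' e => by
    have := hq z (ψ - ψ') fun x hx => by
      rw [LinearMap.sub_apply, sub_eq_zero]
      exact LinearMap.congr_fun e ⟨x, hx⟩
    rwa [LinearMap.sub_apply, sub_eq_zero] at this
  let η : UDDual R S U X :=
    { toFun := fun φ => E φ (q z)
      map_add' := fun φ φ' => hE' _ (E φ + E φ') (by rw [hE, LinearMap.add_comp, hE, hE])
      map_smul' := fun s φ => hE' _ (s • E φ) (by rw [hE, LinearMap.smul_comp, hE]) }
  have key : evalMap R S U _ (K.mkQ (0, z)) = ddualMap R S U i η := by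
    refine H _ _ f hf (isTorsionless_pi p) (LinearMap.ext fun ψ => ?_)
    change ψ (f (K.mkQ (0, z))) = E ((ψ ∘ₗ f) ∘ₗ i) (q z)
    have hfz : f (K.mkQ (0, z)) = q z := by simp [f, g]
    rw [hfz]
    refine hE' _ _ ?_
    rw [hE]
    ext x
    simp [f, g, i]
  have key' := LinearMap.congr_fun key h'
  have hz : evalMap R S U _ (K.mkQ (0, z)) h' = h z := by
    change h' (K.mkQ (0, z)) = h z
    simp [h']
  have hi : h' ∘ₗ i = 0 := by
    ext x
    simp [h', i]
  rw [hz] at key'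
  rw [key']
  change η (h' ∘ₗ i) = 0
  rw [hi, map_zero]

/-- `Ext²(N, U)` is the quotient of the dual of the second syzygy `ker ρ` by the functionals
extending to `S^b`. Generators of `ker ρ` embed that dual in `U^p`, where it lies in the closure of
the submodule `range ρ'` of extendable functionals, so the closure condition applies to the preimage
of `B`. -/
lemma ClosureCondition.strongGradeGE [IsNoetherianRing S]
    (hS : Function.Bijective (Module.toModuleEnd R (S := S) U)) (H : ClosureCondition R U)
    (N : Type u) [AddCommGroup N] [Module S N] [Module.Finite S N] :
    StrongGradeGE R U (ExtU S U N 2) 1 := by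
  intro B
  rw [gradeGE_one_iff]
  intro φ
  have hS₀ : ∀ s : S, (∀ u : U, s • u = 0) → s = 0 := fun s => eq_zero_of_smul_eq_zero hS.1
  obtain ⟨a, π, hπ⟩ := Module.Finite.exists_fin' S N
  obtain ⟨b, ρ, hρ⟩ := Module.Finite.exists_fin' S (LinearMap.ker π)
  obtain ⟨δ, hδ, hδs⟩ := exists_connecting_dual_two (R := S) (U := U) R
    (Submodule.injective_subtype (LinearMap.ker ρ)) hρ (LinearMap.exact_subtype_ker_map ρ)
    (Submodule.injective_subtype (LinearMap.ker π)) hπ (LinearMap.exact_subtype_ker_map π)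
    (subsingleton_ext_of_projective 0)
  have hδs' := hδs (subsingleton_ext_of_projective 0) (subsingleton_ext_of_projective 1)
  obtain ⟨p, m, hm⟩ := Module.Finite.exists_fin (R := S) (M := LinearMap.ker ρ)
  have hm' : ∀ x : LinearMap.ker ρ, ∃ t : Fin p → S, ∑ k, t k • m k = x := fun x => by
    rw [← Submodule.mem_span_range_iff_exists_fun, hm]
    trivial
  let κ : UDual S U (LinearMap.ker ρ) →ₗ[R] (Fin p → U) :=
    LinearMap.pi fun k =>
      { toFun := fun ξ => ξ (m k)
        map_add' := fun _ _ => rfl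
        map_smul' := fun _ _ => rfl }
  have hκ : Function.Injective κ := by
    refine (injective_iff_map_eq_zero _).2 fun ξ hξ => LinearMap.ext fun x => ?_
    obtain ⟨t, rfl⟩ := hm' x
    rw [map_sum]
    refine Finset.sum_eq_zero fun k _ => ?_
    have : ξ (m k) = 0 := congrFun hξ k
    rw [map_smul, this, smul_zero]
  let ρ' : UDual S U (Fin b → S) →ₗ[R] (Fin p → U) := κ ∘ₗ dualMap S R U (LinearMap.ker ρ).subtype
  have hρ' : ∀ q k, ρ' q k = q (m k) := fun _ _ => rfl
  have hext : ∀ φ : LinearMap.range ρ' →ₗ[R] U, ∃ ψ : (Fin p → U) →ₗ[R] U,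
      ψ ∘ₗ (LinearMap.range ρ').subtype = φ := by
    intro φ
    -- As a functional on `(S^b)*`, `φ` is evaluation at a vector `s`. It kills functionals that
    -- vanish on `ker ρ`, in particular those factoring through `ρ`, so `s` lies in `ker ρ`, and its
    -- coefficients on the generators define the extension.
    obtain ⟨s, hs⟩ := evalMap_pi_surjective (R := S) (S := R) (exists_smul_eq hS.2) b
      (φ ∘ₗ ρ'.rangeRestrict)
    have hs' : ∀ q : (Fin b → S) →ₗ[S] U, q s = φ (ρ'.rangeRestrict q) :=
      fun q => LinearMap.congr_fun hs q
    have hsρ : s ∈ LinearMap.ker ρ := by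
      refine Subtype.ext (funext fun j => hS₀ _ fun u => ?_)
      let q : (Fin b → S) →ₗ[S] U := LinearMap.toSpanSingleton S U u ∘ₗ LinearMap.proj j ∘ₗ
        (LinearMap.ker π).subtype ∘ₗ ρ
      have hq : ρ'.rangeRestrict q = 0 := by
        refine Subtype.ext (funext fun k => ?_)
        change q (m k) = 0
        have : ρ (m k) = 0 := (m k).2
        simp [q, this]
      have := hs' q
      rwa [hq, map_zero] at this
    obtain ⟨t, ht⟩ := hm' ⟨s, hsρ⟩
    refine ⟨∑ k, t k • LinearMap.proj k, ?_⟩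
    ext ⟨_, q, rfl⟩
    change _ = φ (ρ'.rangeRestrict q)
    rw [← hs']
    have ht' : s = ∑ k, t k • (m k : Fin b → S) := by
      simpa using (congrArg Subtype.val ht).symm
    rw [ht']
    simp [hρ']
  have hcl : ∀ ξ, κ ξ ∈ dualClosure (LinearMap.range ρ') := by
    intro ξ ψ hψ
    obtain ⟨t, rfl⟩ := linearMap_pi_eq_sum (exists_smul_eq hS.2) ψ
    have h0 : ∑ k, t k • m k = 0 := by
      refine Subtype.ext (eq_zero_of_forall_pi hS₀ fun q => ?_)
      have := hψ _ ⟨q, rfl⟩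
      simpa [LinearMap.sum_apply, hρ'] using this
    have : ξ (∑ k, t k • m k) = 0 := by rw [h0, map_zero]
    simpa [LinearMap.sum_apply, κ] using this
  let δB : B.comap δ →ₗ[R] B := δ.restrict fun _ hx => hx
  have hB := H p _ hext (B.comap δ) (κ ∘ₗ (B.comap δ).subtype) (φ ∘ₗ δB)
    (fun z => hcl _) (fun z hz => by
      obtain ⟨q, hq⟩ := hz
      have h0 : δ z = 0 := (hδ _).2 ⟨q, hκ hq⟩
      have h1 : δB z = 0 := Subtype.ext h0
      rw [LinearMap.comp_apply, h1, map_zero])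
  ext ⟨x, hx⟩
  obtain ⟨ξ, rfl⟩ := hδs' x
  exact LinearMap.congr_fun hB ⟨ξ, hx⟩

/-- Dualizing a presentation of `X` gives `0 → X* → (R^a)* → (R^b)* → N → 0`. A functional on `X*`
has zero image in `Ext²(N, U)` exactly when it extends to `(R^a)*`, and it is then evaluation at a
point of `X`. Thus a submodule `B` of `X**` avoiding `σ(X)` embeds in `Ext²(N, U)` and has no
nonzero map to `U`; but the evaluations at elements of `X*` separate points of `B`. -/
lemma evalEssential_of_strongGradeGE [IsNoetherianRing R] [IsNoetherianRing S] [Module.Finite S U]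
    (hR : ∀ φ : U →ₗ[S] U, ∃ r : R, ∀ u, φ u = r • u) (hU : Subsingleton (ExtU S U U 1))
    (H : ∀ (N : Type u) [AddCommGroup N] [Module S N] [Module.Finite S N],
      StrongGradeGE R U (ExtU S U N 2) 1) : EvalEssential R S U := by
  intro X _ _ _ hX
  refine ⟨hX, fun B hB => ?_⟩
  obtain ⟨a, π, hπ⟩ := Module.Finite.exists_fin' R X
  obtain ⟨b, ρ, hρ⟩ := Module.Finite.exists_fin' R (LinearMap.ker π)
  let ρ₁ : (Fin b → R) →ₗ[R] (Fin a → R) := (LinearMap.ker π).subtype ∘ₗ ρ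
  let D := dualMap R S U ρ₁
  have hD : Function.Exact (dualMap R S U π) D.rangeRestrict := by
    intro φ
    constructor
    · intro h
      have h' : φ ∘ₗ ρ₁ = 0 := congrArg Subtype.val h
      have hle : LinearMap.ker π ≤ LinearMap.ker φ := fun x hx => by
        obtain ⟨y, hy⟩ := hρ ⟨x, hx⟩
        have := LinearMap.congr_fun h' y
        simpa [ρ₁, hy] using this
      refine ⟨(LinearMap.ker π).liftQ φ hle ∘ₗ
        (π.quotKerEquivOfSurjective hπ).symm.toLinearMap, ?_⟩
      refine LinearMap.ext fun v => ?_
      change (LinearMap.ker π).liftQ φ hle ((π.quotKerEquivOfSurjective hπ).symm (π v)) = φ v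
      have hv : (π.quotKerEquivOfSurjective hπ).symm (π v) = (LinearMap.ker π).mkQ v := by
        rw [LinearEquiv.symm_apply_eq]; rfl
      rw [hv]
      simp
    · rintro ⟨ψ, rfl⟩
      refine Subtype.ext (LinearMap.ext fun y => ?_)
      change ψ (π (ρ y)) = 0
      have : π (ρ y) = 0 := (ρ y).2
      rw [this, map_zero]
  have hinj : Function.Injective (dualMap R S U π) := fun φ ψ h => by
    ext x
    obtain ⟨v, rfl⟩ := hπ x
    exact LinearMap.congr_fun h v
  have := isNoetherian_dual R S U (Fin b → R)
  obtain ⟨δ, hδ, -⟩ := exists_connecting_dual_two (R := S) (U := U) R hinj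
    D.surjective_rangeRestrict hD (Submodule.injective_subtype (LinearMap.range D))
    (Submodule.mkQ_surjective _) (LinearMap.exact_subtype_mkQ _)
    ((isAdd_dual_pi (R := R) (S := S) (U := U) b).subsingleton_ext 1 hU)
  have hδB : Function.Injective (δ.domRestrict B) := by
    refine (injective_iff_map_eq_zero _).2 fun ξ hξ => ?_
    obtain ⟨ψ, hψ⟩ := (hδ ξ).1 hξ
    obtain ⟨v, rfl⟩ := evalMap_pi_surjective hR a ψ
    have : (ξ : UDDual R S U X) ∈ LinearMap.range (evalMap R S U X) ⊓ B :=
      ⟨⟨π v, hψ⟩, ξ.2⟩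
    rw [hB] at this
    exact Subtype.ext this
  rw [eq_bot_iff]
  intro ξ hξ
  refine LinearMap.ext fun f => ?_
  let ev : UDDual R S U X →ₗ[R] U :=
    { toFun := fun ξ => ξ f
      map_add' := fun _ _ => rfl
      map_smul' := fun _ _ => rfl }
  let e := LinearEquiv.ofInjective _ hδB
  have h0 := (gradeGE_one_iff (R := R) (U := U) _).1 (H _ (LinearMap.range (δ.domRestrict B)))
    ((ev ∘ₗ B.subtype) ∘ₗ e.symm.toLinearMap)
  have := LinearMap.congr_fun h0 (e ⟨ξ, hξ⟩)
  simp only [LinearMap.comp_apply, LinearEquiv.coe_coe, LinearEquiv.symm_apply_apply] at this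
  exact this

/-- For a first syzygy `K ⊆ R^n` of `X`, `K*` surjects onto `Ext¹(X, U)`. A map `Ext¹(X, U) → U`
thus becomes an element of `K**` that dies in `(R^n)**`, and `R^n` is torsionless because `U` is
faithful. -/
lemma DDualPreservesMono.gradeGE_ext_one [IsNoetherianRing R]
    (hR : ∀ r : R, (∀ u : U, r • u = 0) → r = 0) (H : DDualPreservesMono R S U)
    (X : Type u) [AddCommGroup X] [Module R X] [Module.Finite R X] :
    GradeGE S U (ExtU R U X 1) 1 := by
  rw [gradeGE_one_iff]
  intro φ
  obtain ⟨n, π, hπ⟩ := Module.Finite.exists_fin' R X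
  obtain ⟨δ, hδ, hδs⟩ := exists_connecting_dual (R := R) (U := U) S
    (Submodule.injective_subtype (LinearMap.ker π)) hπ (LinearMap.exact_subtype_ker_map π)
  have h0 : φ ∘ₗ δ = 0 := by
    refine (injective_iff_map_eq_zero _).1 (H _ _ (LinearMap.ker π).subtype
      (Submodule.injective_subtype _) (isTorsionless_of_forall fun _ => eq_zero_of_forall_pi hR))
      (φ ∘ₗ δ : UDDual R S U _) (LinearMap.ext fun ψ => ?_)
    change φ (δ (ψ ∘ₗ (LinearMap.ker π).subtype)) = 0
    rw [(hδ _).2 ⟨ψ, rfl⟩, map_zero]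
  ext x
  obtain ⟨ξ, rfl⟩ := hδs (subsingleton_ext_of_projective 0) x
  exact LinearMap.congr_fun h0 ξ

/-- Embed `Y` in `U^p` and let `C` be the cokernel of `X → U^p`. An element of `ker f**` kills the
functionals on `X` that extend to `U^p`, so it factors through `Ext¹(C, U)`, a quotient of `X*`
since `Ext¹(U^p, U) = 0`. -/
lemma ddualPreservesMono_of_gradeGE_ext_one [IsNoetherianRing S] [Module.Finite R U]
    [Module.Finite S U] (hU : Subsingleton (ExtU R U U 1))
    (H : ∀ (X : Type u) [AddCommGroup X] [Module R X] [Module.Finite R X],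
      GradeGE S U (ExtU R U X 1) 1) : DDualPreservesMono R S U := by
  intro X Y _ _ _ _ _ _ f hf hY
  obtain ⟨p, i, hi⟩ := hY.exists_injective
  refine (injective_iff_map_eq_zero _).2 fun ξ hξ => ?_
  have hif : Function.Injective (i ∘ₗ f) := hi.comp hf
  obtain ⟨δ, hδ, hδs⟩ := exists_connecting_dual (U := U) S hif
    (Submodule.mkQ_surjective (LinearMap.range (i ∘ₗ f))) (LinearMap.exact_map_mkQ_range _)
  have hδs' := hδs (subsingleton_ext_pi 1 hU)
  have hker : LinearMap.ker δ ≤ LinearMap.ker ξ := fun φ hφ => by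
    obtain ⟨ψ, rfl⟩ := (hδ φ).1 hφ
    exact LinearMap.congr_fun hξ (ψ ∘ₗ i)
  have h0 := (gradeGE_one_iff (R := S) (U := U) _).1 (H _)
    ((LinearMap.ker δ).liftQ ξ hker ∘ₗ (δ.quotKerEquivOfSurjective hδs').symm.toLinearMap)
  refine LinearMap.ext fun φ => ?_
  have hφ : (δ.quotKerEquivOfSurjective hδs').symm (δ φ) = (LinearMap.ker δ).mkQ φ := by
    rw [LinearEquiv.symm_apply_eq]; rfl
  have := LinearMap.congr_fun h0 (δ φ)
  simpa [hφ] using this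

end Equivalences

/-! ### The limit dimension of the injective envelope and the closure condition -/

section LimDim

variable {R U E : Type u} [Ring R] [AddCommGroup U] [Module R U] [AddCommGroup E] [Module R E]

/-- `T-lim.dim M ≤ 1` as the existence of a two-term resolution. -/
lemma limDim_le_one_iff : limDim R U E ≤ 1 ↔
    ∃ (T₀ T₁ : ModuleCat.{u} R) (ε : T₀ →ₗ[R] E) (d : T₁ →ₗ[R] T₀), IsAddLim R U T₀ ∧
      IsAddLim R U T₁ ∧ Function.Surjective ε ∧ Function.Exact d ε ∧ Function.Injective d := by
  constructor
  · intro h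
    -- An empty set of lengths would give infimum `⊤`; otherwise the infimum is attained.
    have hne : {m : ℕ∞ | ∃ n : ℕ, m = n ∧ HasLimResolution R U E n}.Nonempty := by
      by_contra hne
      rw [Set.not_nonempty_iff_eq_empty] at hne
      rw [limDim, hne, sInf_empty] at h
      exact absurd h (by decide)
    obtain ⟨n, hn, W, ε, d, hW, hW', hε, hd, hd'⟩ := csInf_mem hne
    have hn1 : n ≤ 1 := by
      rw [limDim, hn] at h
      exact_mod_cast h
    have : Subsingleton (W 2) := hW' 2 (by omega)
    refine ⟨W 0, W 1, ε, d 0, hW 0, hW 1, hε, hd, (injective_iff_map_eq_zero _).2 fun x hx => ?_⟩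
    obtain ⟨y, rfl⟩ := (hd' 0 x).1 hx
    rw [Subsingleton.elim y 0, map_zero]
  · rintro ⟨T₀, T₁, ε, d, h₀, h₁, hε, hex, hd⟩
    -- The zero module, as the limit of the constant system `U^0`, pads the resolution from degree 2
    -- on.
    have hzero : IsAddLim R U (ModuleCat.of R PUnit.{u + 1}) :=
      ⟨PUnit, inferInstance, inferInstance, inferInstance,
        (Functor.const _).obj (ModuleCat.of R (Fin 0 → U)), Limits.constCocone _ _,
        Limits.isColimitConstCocone _ _, 0, 0, fun _ => ⟨0, ⟨LinearEquiv.refl R _⟩⟩,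
        Subsingleton.elim _ _⟩
    refine sInf_le ⟨1, rfl, fun | 0 => T₀ | 1 => T₁ | _ + 2 => ModuleCat.of R PUnit, ε,
      fun | 0 => d | _ + 1 => 0, ?_, ?_, hε, hex, ?_⟩
    · rintro (_ | _ | i)
      · exact h₀
      · exact h₁
      · exact hzero
    · rintro (_ | _ | i) hi
      · omega
      · omega
      · exact inferInstanceAs (Subsingleton PUnit)
    · rintro (_ | i) x
      · refine ⟨fun hx => ⟨0, ?_⟩, ?_⟩
        · exact ((injective_iff_map_eq_zero d).1 hd x hx).symm
        · rintro ⟨y, rfl⟩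
          exact map_zero d
      · exact ⟨fun _ => ⟨0, Subsingleton.elim (α := PUnit) _ _⟩, fun _ => rfl⟩

omit [AddCommGroup E] [Module R E] in
/-- Homomorphisms into a direct sum of copies of `U` extend along approximations by finite powers
of `U`. -/
lemma exists_extension_finsupp {I : Type u} {F : Type u} [AddCommGroup F] [Module R F]
    [Module.Finite R F] {p : ℕ} (i : F →ₗ[R] (Fin p → U))
    (hi : ∀ φ : F →ₗ[R] U, ∃ ψ : (Fin p → U) →ₗ[R] U, ψ ∘ₗ i = φ) (f : F →ₗ[R] (I →₀ U)) :
    ∃ a : (Fin p → U) →ₗ[R] (I →₀ U), a ∘ₗ i = f := by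
  classical
  choose ext hext using hi
  obtain ⟨k, w, hw⟩ := Module.Finite.exists_fin (R := R) (M := F)
  let J : Finset I := Finset.univ.biUnion fun l => (f (w l)).support
  have hJ : ∀ x, ∀ c ∉ J, f x c = 0 := by
    intro x c hc
    have hx : x ∈ Submodule.span R (Set.range w) := hw ▸ Submodule.mem_top
    refine Submodule.span_induction (p := fun x _ => f x c = 0) ?_ ?_ ?_ ?_ hx
    · rintro _ ⟨l, rfl⟩
      by_contra h
      exact hc (Finset.mem_biUnion.2 ⟨l, Finset.mem_univ _, Finsupp.mem_support_iff.2 h⟩)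
    · simp
    · intro y z _ _ hy hz
      simp [hy, hz]
    · intro r y _ hy
      simp [hy]
  refine ⟨∑ c ∈ J, Finsupp.lsingle c ∘ₗ ext (Finsupp.lapply c ∘ₗ f), ?_⟩
  refine LinearMap.ext fun x => Finsupp.ext fun c => ?_
  have hc : ∀ c, ext (Finsupp.lapply c ∘ₗ f) (i x) = f x c := fun c =>
    LinearMap.congr_fun (hext (Finsupp.lapply c ∘ₗ f)) x
  simp only [LinearMap.comp_apply, LinearMap.sum_apply, Finsupp.finsetSum_apply,
    Finsupp.lsingle_apply, hc, Finsupp.single_apply, Finset.sum_ite_eq']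
  split_ifs with h
  · rfl
  · exact (hJ x c h).symm

/-- For `X ≤ U^p` as in the closure condition, homomorphisms from `U^p` to the injective envelope
of `U` that vanish on `X` vanish on the closure of `X`. -/
lemma ClosureCondition.eq_zero_of_isInjectiveEnvelope (H : ClosureCondition R U) {j : U →ₗ[R] E}
    (hj : IsInjectiveEnvelope j) {p : ℕ} {X : Submodule R (Fin p → U)}
    (hX : ∀ φ : X →ₗ[R] U, ∃ ψ : (Fin p → U) →ₗ[R] U, ψ ∘ₗ X.subtype = φ)
    (g : (Fin p → U) →ₗ[R] E) (hg : ∀ x ∈ X, g x = 0) : ∀ v ∈ dualClosure X, g v = 0 := by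
  suffices (dualClosure X).map g = ⊥ by
    intro v hv
    have h := Submodule.mem_map_of_mem (f := g) hv
    rwa [this] at h
  refine hj.2.2 _ (eq_bot_iff.2 ?_)
  rintro _ ⟨⟨u, rfl⟩, v, hv, hvu⟩
  -- On the part of the closure that `g` sends into `j(U)`, `g` has the form `j ∘ h` with `h`
  -- vanishing on `X`. The closure condition gives `h = 0`, so the image of the closure avoids
  -- `j(U)` and essentiality applies.
  let Z : Submodule R (Fin p → U) := dualClosure X ⊓ (LinearMap.range j).comap g
  let ej := LinearEquiv.ofInjective j hj.2.1
  let h : Z →ₗ[R] U := ej.symm.toLinearMap ∘ₗ g.restrict (p := Z) (q := LinearMap.range j)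
    (fun z hz => hz.2)
  have hjh : ∀ z : Z, j (h z) = g z := fun z => congrArg Subtype.val (ej.apply_symm_apply
    (g.restrict (p := Z) (q := LinearMap.range j) (fun z hz => hz.2) z))
  have h0 := H p X hX Z Z.subtype h (fun z => z.2.1) (fun z hz => hj.2.1 (by
    rw [hjh, map_zero]
    exact hg _ hz))
  have hz := hjh ⟨v, hv, u, hvu.symm⟩
  rw [h0, LinearMap.zero_apply, map_zero] at hz
  rw [← hvu]
  exact hz.symm

variable {S : Type u} [Ring S] [Module S U] [SMulCommClass R S U] [SMulCommClass S R U]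

omit [SMulCommClass S R U] in
-- The resolution starts with one copy of `U` for each map `U → E`. This sum covers `E` because `R`
-- embeds in some `U^n` and `E` is injective. The closure condition serves to show that the kernel
-- has the factorization property.
lemma ClosureCondition.limDim_le_one [IsNoetherianRing S] [Module.Finite R U]
    [Module.Finite S U] (hS : ∀ φ : U →ₗ[R] U, ∃ s : S, ∀ u, φ u = s • u)
    (hemb : ∃ (n : ℕ) (e : R →ₗ[R] (Fin n → U)), Function.Injective e)
    (H : ClosureCondition R U) {j : U →ₗ[R] E} (hj : IsInjectiveEnvelope j) :
    limDim R U E ≤ 1 := by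
  have hE := hj.1
  let ε : ((U →ₗ[R] E) →₀ U) →ₗ[R] E := Finsupp.lsum ℕ fun f => f
  have hεs : ∀ f u, ε (Finsupp.single f u) = f u := fun f u => by simp [ε]
  have hε : Function.Surjective ε := by
    intro x
    obtain ⟨n, e, he⟩ := hemb
    obtain ⟨h, hh⟩ := hE.out e he (LinearMap.toSpanSingleton R E x)
    refine ⟨∑ k, Finsupp.single (h ∘ₗ LinearMap.single R (fun _ => U) k) (e 1 k), ?_⟩
    have h1 : e 1 = ∑ k, Pi.single k (e 1 k) := (Finset.univ_sum_single _).symm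
    have h2 := hh 1
    rw [h1] at h2
    simpa [hεs] using h2
  have hT₀ : HasFactorization R U ((U →ₗ[R] E) →₀ U) := by
    intro F _ _ _ f
    obtain ⟨p, i, hi⟩ := exists_approximation (R := R) (S := S) (U := U) F
    obtain ⟨a, ha⟩ := exists_extension_finsupp i hi f
    exact ⟨p, i, a, ha⟩
  have hT₁ : HasFactorization R U (LinearMap.ker ε) := by
    intro F _ _ _ f
    obtain ⟨p, i, hi⟩ := exists_approximation (R := R) (S := S) (U := U) F
    obtain ⟨a, ha⟩ := exists_extension_finsupp i hi ((LinearMap.ker ε).subtype ∘ₗ f)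
    have hX : ∀ φ : LinearMap.range i →ₗ[R] U, ∃ ψ : (Fin p → U) →ₗ[R] U,
        ψ ∘ₗ (LinearMap.range i).subtype = φ := fun φ => by
      obtain ⟨ψ, hψ⟩ := hi (φ ∘ₗ i.rangeRestrict)
      refine ⟨ψ, ?_⟩
      ext ⟨_, x, rfl⟩
      exact LinearMap.congr_fun hψ x
    have hcl := H.eq_zero_of_isInjectiveEnvelope hj hX (ε ∘ₗ a) (by
      rintro _ ⟨x, rfl⟩
      have h1 : a (i x) = f x := LinearMap.congr_fun ha x
      rw [LinearMap.comp_apply, h1]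
      exact (f x).2)
    have := finite_dual_pi hS p
    have : IsNoetherian S (UDual R U (Fin p → U)) := isNoetherian_of_isNoetherianRing_of_finite _ _
    -- The coordinates of `b` generate the functionals vanishing on `range i`, so `ker b` lies in
    -- the closure of that range and `ε ∘ a` factors through the image of `b`.
    obtain ⟨q, b, hb, hb'⟩ := exists_generators (LinearMap.ker (dualMap R S U i))
    have hbi : ∀ x, b (i x) = 0 := fun x => funext fun k => LinearMap.congr_fun (hb k) x
    have hker : LinearMap.ker b ≤ LinearMap.ker (ε ∘ₗ a) := by
      intro v hv
      refine hcl v fun ψ hψ => ?_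
      obtain ⟨t, rfl⟩ := hb' ψ (LinearMap.ext fun x => hψ _ ⟨x, rfl⟩)
      have hv' : b v = 0 := hv
      simp [LinearMap.sum_apply, hv']
    obtain ⟨c, hc⟩ := hE.out ((LinearMap.ker b).liftQ b le_rfl)
      (LinearMap.ker_eq_bot.1 (Submodule.ker_liftQ_eq_bot _ _ _ le_rfl))
      ((LinearMap.ker b).liftQ (ε ∘ₗ a) hker)
    have hc' : ∀ v, c (b v) = ε (a v) := fun v => by
      simpa using hc ((LinearMap.ker b).mkQ v)
    -- The components of `c` are themselves indices of the direct sum, so `c` lifts tautologically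
    -- along `ε`. Subtracting the lift of `c ∘ b` moves `a` into `ker ε` without changing it on `F`,
    -- since `b ∘ i = 0`.
    let a' : (Fin p → U) →ₗ[R] ((U →ₗ[R] E) →₀ U) := a - ∑ k, Finsupp.lsingle
      (c ∘ₗ LinearMap.single R (fun _ => U) k) ∘ₗ LinearMap.proj k ∘ₗ b
    have ha' : ∀ v, ε (a' v) = 0 := fun v => by
      have h1 : c (b v) = ∑ k, c (Pi.single k (b v k)) := by
        rw [← map_sum, Finset.univ_sum_single]
      simp only [a', LinearMap.sub_apply, LinearMap.sum_apply, map_sub, map_sum]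
      rw [← hc', h1, sub_eq_zero]
      refine Finset.sum_congr rfl fun k _ => ?_
      simp [hεs]
    refine ⟨p, i, a'.codRestrict _ ha', ?_⟩
    refine LinearMap.ext fun x => Subtype.ext ?_
    have h1 : a (i x) = f x := LinearMap.congr_fun ha x
    change a' (i x) = f x
    simp [a', h1, hbi, LinearMap.sum_apply]
  exact limDim_le_one_iff.2 ⟨ModuleCat.of R ((U →ₗ[R] E) →₀ U), ModuleCat.of R (LinearMap.ker ε), ε,
    (LinearMap.ker ε).subtype, hT₀.isAddLim, hT₁.isAddLim, hε, LinearMap.exact_subtype_ker_map ε,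
    Submodule.injective_subtype _⟩

omit [Module S U] [SMulCommClass R S U] [SMulCommClass S R U] in
-- `T₁` enters only through maps from finitely generated modules, which pass through powers of `U`.
-- Hence `Ext¹(U, U) = 0` and the extension hypothesis on `X` suffice to correct maps into `T₀` by
-- maps into `T₁`.
lemma closureCondition_of_limDim_le_one [IsNoetherianRing R] [Module.Finite R U]
    (hU : Subsingleton (ExtU R U U 1)) {j : U →ₗ[R] E} (hj : IsInjectiveEnvelope j)
    (h : limDim R U E ≤ 1) : ClosureCondition R U := by
  have hE := hj.1
  obtain ⟨T₀, T₁, ε, d, hT₀, hT₁, hε, hex, hd⟩ := limDim_le_one_iff.1 h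
  replace hT₀ := hT₀.hasFactorization
  replace hT₁ := hT₁.hasFactorization
  -- lifting of homomorphisms along `d`
  have hlift : ∀ {F : Type u} [AddCommGroup F] [Module R F] (f : F →ₗ[R] T₀),
      (∀ x, ε (f x) = 0) → ∃ f' : F →ₗ[R] T₁, ∀ x, d (f' x) = f x := by
    intro F _ _ f hf
    let e := LinearEquiv.ofInjective d hd
    refine ⟨e.symm.toLinearMap ∘ₗ f.codRestrict (LinearMap.range d) fun x => (hex _).1 (hf x),
      fun x => ?_⟩
    exact congrArg Subtype.val (e.apply_symm_apply
      (f.codRestrict (LinearMap.range d) (fun x => (hex _).1 (hf x)) x))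
  have hextpi : ∀ {A V : Type u} [AddCommGroup A] [Module R A] [AddCommGroup V] [Module R V]
      (i : A →ₗ[R] V), (∀ φ : A →ₗ[R] U, ∃ ψ : V →ₗ[R] U, ψ ∘ₗ i = φ) →
      ∀ {m : ℕ} (φ : A →ₗ[R] (Fin m → U)), ∃ ψ : V →ₗ[R] (Fin m → U), ψ ∘ₗ i = φ := by
    intro A V _ _ _ _ i hi m φ
    choose ψ hψ using fun k => hi (LinearMap.proj k ∘ₗ φ)
    refine ⟨LinearMap.pi ψ, ?_⟩
    ext x k
    exact LinearMap.congr_fun (hψ k) x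
  intro p X hX Z _ _ q h hq hh
  -- extend `j ∘ h` to a homomorphism `U^p → E` vanishing on `X`
  obtain ⟨g, hgX, hgq⟩ : ∃ g : (Fin p → U) →ₗ[R] E, (∀ x ∈ X, g x = 0) ∧
      ∀ z, g (q z) = j (h z) := by
    -- The map `j ∘ h` descends to the image of `Z` in `U^p / X`, and injectivity of `E` extends it
    -- to the whole quotient.
    let q' : Z →ₗ[R] ((Fin p → U) ⧸ X) := X.mkQ ∘ₗ q
    have hle : LinearMap.ker q' ≤ LinearMap.ker (j ∘ₗ h) := fun z hz => by
      have hz' : q z ∈ X := by simpa [q'] using hz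
      rw [LinearMap.mem_ker, LinearMap.comp_apply, hh z hz', map_zero]
    obtain ⟨g, hg⟩ := hE.out ((LinearMap.ker q').liftQ q' le_rfl)
      (LinearMap.ker_eq_bot.1 (Submodule.ker_liftQ_eq_bot _ _ _ le_rfl))
      ((LinearMap.ker q').liftQ (j ∘ₗ h) hle)
    refine ⟨g ∘ₗ X.mkQ, fun x hx => ?_, fun z => ?_⟩
    · have : X.mkQ x = 0 := by simpa using hx
      rw [LinearMap.comp_apply, this, map_zero]
    · simpa [q'] using hg ((LinearMap.ker q').mkQ z)
  -- lift `g` to `T₀`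
  obtain ⟨a, ha⟩ : ∃ a : (Fin p → U) →ₗ[R] T₀, ∀ v, ε (a v) = g v := by
    obtain ⟨k, π, hπ⟩ := Module.Finite.exists_fin' R (Fin p → U)
    choose y hy using fun l => hε (g (π (Pi.single l 1)))
    let b : (Fin k → R) →ₗ[R] T₀ := (Pi.basisFun R (Fin k)).constr ℕ y
    have hb : ∀ w, ε (b w) = g (π w) := fun w => by
      have : ε ∘ₗ b = g ∘ₗ π := (Pi.basisFun R (Fin k)).ext fun l => by
        simp only [LinearMap.comp_apply, b, Module.Basis.constr_basis, hy]
        simp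
      exact LinearMap.congr_fun this w
    -- On the relations `ker π` the lift `b` lands in `T₁`. That restriction factors through some
    -- `U^m` and extends to the free module because `Ext¹(U^p, U) = 0`; subtracting the extension
    -- makes `b` descend to `U^p`.
    obtain ⟨f, hf⟩ := hlift (b ∘ₗ (LinearMap.ker π).subtype) fun x => by
      have h1 : π x = 0 := x.2
      simp [hb, h1]
    obtain ⟨m, i, c, hic⟩ := hT₁ _ f
    obtain ⟨i', hi'⟩ := hextpi (LinearMap.ker π).subtype (exists_extension
      (Submodule.injective_subtype _) hπ (LinearMap.exact_subtype_ker_map π)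
      (subsingleton_ext_pi 1 hU)) i
    let b' : (Fin k → R) →ₗ[R] T₀ := b - d ∘ₗ c ∘ₗ i'
    have hb' : LinearMap.ker π ≤ LinearMap.ker b' := fun x hx => by
      have h1 : i' x = i ⟨x, hx⟩ := LinearMap.congr_fun hi' ⟨x, hx⟩
      have h2 : c (i ⟨x, hx⟩) = f ⟨x, hx⟩ := LinearMap.congr_fun hic _
      have h3 : d (f ⟨x, hx⟩) = b x := hf ⟨x, hx⟩
      simp [b', h1, h2, h3]
    refine ⟨(LinearMap.ker π).liftQ b' hb' ∘ₗ (π.quotKerEquivOfSurjective hπ).symm.toLinearMap,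
      fun v => ?_⟩
    obtain ⟨w, rfl⟩ := hπ v
    have hw : (π.quotKerEquivOfSurjective hπ).symm (π w) = (LinearMap.ker π).mkQ w := by
      rw [LinearEquiv.symm_apply_eq]; rfl
    have h1 : ε (b' w) = g (π w) := by
      simp [b', hb, hex.apply_apply_eq_zero]
    simpa [hw] using h1
  -- modify the lift to vanish on `X`
  obtain ⟨a', haX, ha'⟩ : ∃ a' : (Fin p → U) →ₗ[R] T₀, (∀ x ∈ X, a' x = 0) ∧
      ∀ v, ε (a' v) = g v := by
    obtain ⟨f, hf⟩ := hlift (a ∘ₗ X.subtype) fun x => by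
      rw [LinearMap.comp_apply, ha]
      exact hgX _ x.2
    obtain ⟨m, i, c, hic⟩ := hT₁ _ f
    obtain ⟨i', hi'⟩ := hextpi X.subtype hX i
    refine ⟨a - d ∘ₗ c ∘ₗ i', fun x hx => ?_, fun v => ?_⟩
    · have h1 : i' x = i ⟨x, hx⟩ := LinearMap.congr_fun hi' ⟨x, hx⟩
      have h2 : c (i ⟨x, hx⟩) = f ⟨x, hx⟩ := LinearMap.congr_fun hic _
      have h3 : d (f ⟨x, hx⟩) = a x := hf ⟨x, hx⟩
      simp [h1, h2, h3]
    · simp [ha, hex.apply_apply_eq_zero]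
  -- the modified lift factors through a finite power of `U`, hence vanishes on the closure
  obtain ⟨m, i, c, hic⟩ := hT₀ _ (X.liftQ a' fun x hx => LinearMap.mem_ker.2 (haX x hx))
  have hi : ∀ v ∈ dualClosure X, i (X.mkQ v) = 0 := fun v hv => funext fun k =>
    hv (LinearMap.proj k ∘ₗ i ∘ₗ X.mkQ) fun x hx => by
      have : X.mkQ x = 0 := by simpa using hx
      simp only [LinearMap.comp_apply, this, map_zero]
  ext z
  refine hj.2.1 ?_
  have h1 : c (i (X.mkQ (q z))) = a' (q z) := by
    have := LinearMap.congr_fun hic (X.mkQ (q z))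
    rwa [LinearMap.comp_apply, Submodule.mkQ_apply, Submodule.liftQ_apply] at this
  rw [← hgq, ← ha', ← h1, hi _ (hq z), map_zero, map_zero, LinearMap.zero_apply, map_zero]

end LimDim

end UDim

/-! ### Assembly of the implications -/

theorem proposition5p1
    (Λ Γ U E₀ : Type u) [Ring Λ] [Ring Γ]
    -- `Λ` and `Γ` are left and right noetherian
    [IsNoetherianRing Λ] [IsNoetherianRing Λᵐᵒᵖ] [IsNoetherianRing Γ] [IsNoetherianRing Γᵐᵒᵖ]
    -- `U` is a left `Λ`- right `Γ`-bimodule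
    [AddCommGroup U] [Module Λ U] [Module Γᵐᵒᵖ U]
    [SMulCommClass Λ Γᵐᵒᵖ U] [SMulCommClass Γᵐᵒᵖ Λ U]
    -- `U` is Wakamatsu tilting over `Λ`, and `Γ = End_Λ(U)` (acting on the right of `U`)
    (hU : UDim.IsWakamatsuTilting Λ U)
    (hΓ : Function.Bijective (Module.toModuleEnd Λ (S := Γᵐᵒᵖ) U))
    -- `E₀` is the injective envelope of `U` over `Λ`
    [AddCommGroup E₀] [Module Λ E₀] (j : U →ₗ[Λ] E₀) (hj : UDim.IsInjectiveEnvelope j) :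
    List.TFAE [
      UDim.limDim Λ U E₀ ≤ 1,
      ∀ (X : Type u) [AddCommGroup X] [Module Λ X] [Module.Finite Λ X],
        UDim.IsTorsionless Λ Γᵐᵒᵖ U X → UDim.IsEssentialMono (UDim.evalMap Λ Γᵐᵒᵖ U X),
      ∀ (X Y : Type u) [AddCommGroup X] [Module Λ X] [Module.Finite Λ X]
        [AddCommGroup Y] [Module Λ Y] [Module.Finite Λ Y] (f : X →ₗ[Λ] Y),
        Function.Injective f → UDim.IsTorsionless Λ Γᵐᵒᵖ U Y →
          Function.Injective (UDim.ddualMap Λ Γᵐᵒᵖ U f),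
      ∀ (X Y : Type u) [AddCommGroup X] [Module Λ X] [Module.Finite Λ X]
        [AddCommGroup Y] [Module Λ Y] [Module.Finite Λ Y] (f : X →ₗ[Λ] Y),
        Function.Injective f → UDim.IsTorsionless Λ Γᵐᵒᵖ U X → UDim.IsTorsionless Λ Γᵐᵒᵖ U Y →
          Function.Injective (UDim.ddualMap Λ Γᵐᵒᵖ U f),
      ∀ (X : Type u) [AddCommGroup X] [Module Λ X] [Module.Finite Λ X],
        UDim.GradeGE Γᵐᵒᵖ U (UDim.ExtU Λ U X 1) 1,
      ∀ (N : Type u) [AddCommGroup N] [Module Γᵐᵒᵖ N] [Module.Finite Γᵐᵒᵖ N],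
        UDim.StrongGradeGE Λ U (UDim.ExtU Γᵐᵒᵖ U N 2) 1] := by
  have := hU.finite
  have hU₁ : Subsingleton (UDim.ExtU Λ U U 1) := hU.selfOrthogonal 1 le_rfl
  obtain ⟨_, hend, hU₁', hemb⟩ := hU.dual hΓ
  have hfaithful : ∀ r : Λ, (∀ u : U, r • u = 0) → r = 0 := fun r hr => by
    obtain ⟨n, e, he⟩ := hemb
    refine he ?_
    rw [map_zero, ← mul_one r, ← smul_eq_mul, map_smul]
    exact funext fun k => hr _
  tfae_have 1 → 6 := fun h N =>
    (UDim.closureCondition_of_limDim_le_one hU₁ hj h).strongGradeGE hΓ N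
  tfae_have 6 → 2 := UDim.evalEssential_of_strongGradeGE hend hU₁'
  tfae_have 2 → 3 := UDim.EvalEssential.ddualPreservesMono
  tfae_have 3 → 4 := fun h X Y _ _ _ _ _ _ f hf _ hY => h X Y f hf hY
  tfae_have 4 → 3 := fun h X Y _ _ _ _ _ _ f hf hY => h X Y f hf (hY.of_injective hf) hY
  tfae_have 3 → 5 := fun h X => UDim.DDualPreservesMono.gradeGE_ext_one hfaithful h X
  tfae_have 5 → 3 := UDim.ddualPreservesMono_of_gradeGE_ext_one hU₁
  tfae_have 3 → 1 := fun h => (UDim.DDualPreservesMono.closureCondition h).limDim_le_one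
    (UDim.exists_smul_eq hΓ.2) hemb hj
  tfae_finish
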